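/- Let $k\ge 0$ and $d_1,\dots,d_k\ge 1$ be integers, let $D=\sum_{i=1}^k d_i$, and decompose $\mathbb{R}^D=\prod_{i=1}^k\mathbb{R}^{d_i}$, with $\Pi_i:\mathbb{R}^D\to\mathbb{R}^{d_i}$ the projection onto the $i$-th block. Let $A$ be a (symmetric) positive semi-definite real $D\times D$ matrix, let $X\sim\gamma_A=\mathcal{N}(0,A)$ be a centered Gaussian vector in $\mathbb{R}^D$ with covariance matrix $A$, and write $X_i=\Pi_iX$. For a $k\times k$ matrix $M$, let $\mathcal{E}_{d_1,\dots,d_k}(M)$ be the $D\times D$ matrix obtained by expanding each entry $M_{ij}$ into a constant $d_i\times d_j$ block; let $\odot$ be the entrywise product of matrices, and let $B\succcurlyeq 0$ mean that $B$ is positive semi-definite. Let $\Omega_1,\dots,\Omega_k\subseteq\mathbb{R}$ be open intervals (bounded or not), let $\Omega=\prod_{i=1}^k\Omega_i$, and let $J:\Omega\to\mathbb{R}$ be a bounded $\mathcal{C}^2$ function, with Hessian matrix $\operatorname{Hess}J(x)$ at $x\in\Omega$. Then the following are equivalent: (a) for every $x\in\Omega$, $A\odot\mathcal{E}_{d_1,\dots,d_k}(\operatorname{Hess}J(x))\succcurlyeq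 0$; (b) for every $k$-tuple of measurable functions $f_i:\mathbb{R}^{d_i}\to\Omega_i$ such that each $f_i(X_i)$ is integrable, $$\mathbb{E}\,J(f_1(X_1),\dots,f_k(X_k))\ \ge\ J(\mathbb{E}f_1(X_1),\dots,\mathbb{E}f_k(X_k)).$$ -/

import Mathlib

open MeasureTheory ProbabilityTheory
open scoped Matrix

namespace GaussianJensen

/-- Index set of the coordinates of `ℝ^D = ∏ i, ℝ^(d i)`, where `D = ∑ i, d i`:
the pair `⟨i, j⟩` is the `j`-th coordinate of the `i`-th block. -/
abbrev BlockIndex {k : ℕ} (d : Fin k → ℕ) : Type := (i : Fin k) × Fin (d i)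

/-- The projection `Π_i` of `ℝ^D = ∏ i, ℝ^(d i)` onto its `i`-th block. -/
def blockProj {k : ℕ} (d : Fin k → ℕ) (i : Fin k)
    (x : EuclideanSpace ℝ (BlockIndex d)) : EuclideanSpace ℝ (Fin (d i)) :=
  WithLp.toLp 2 (fun j => x ⟨i, j⟩)

/-- The `D × D` matrix obtained from a `k × k` matrix `M` by expanding each entry `M i j` into a
constant `d i × d j` block. -/
def blockExpand {k : ℕ} (d : Fin k → ℕ) (M : Matrix (Fin k) (Fin k) ℝ) :
    Matrix (BlockIndex d) (BlockIndex d) ℝ :=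
  Matrix.of fun p q => M p.1 q.1

/-- The Hessian matrix `(∂_i ∂_j J (x))` of a function of `k` real variables. -/
noncomputable def hessian {k : ℕ} (J : (Fin k → ℝ) → ℝ) (x : Fin k → ℝ) :
    Matrix (Fin k) (Fin k) ℝ :=
  Matrix.of fun i j => fderiv ℝ (fderiv ℝ J) x (Pi.single i 1) (Pi.single j 1)

end GaussianJensen

/-! For (a) ⇒ (b), `X` has the law of a sum of `n` independent copies of `X / √n`, and Jensen's
inequality is proved one small increment at a time (`exists_jensen_one_step`). For an increment `r •
Z`, expand `J` to second order at the mean of the vector `f` of values. The linear term integrates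
to zero. To leading order `f` minus its mean is `r` times a block-linear functional of `Z`, so the
quadratic term integrates to `r ^ 2 / 2` times a value of the quadratic form of `A ⊙ blockExpand d
(Hess J)`, which is nonnegative. The loss is at most `ε * r ^ 2`, and `n` steps with `r ^ 2 = 1 / n`
lose at most `ε` (`jensen_iterate`, `jensen_of_quadApprox`).

The iteration needs a class of functions on which the one-step error is uniform and which survives
averaging over an increment. `QuadApprox L` is such a class: averaging preserves it with the same
`L`, and no differentiation under the integral is needed. Density in `L¹` gives functions with
values in compact intervals (`jensen_of_mem_Icc`); truncation and dominated convergence give the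
rest (`jensen_of_posSemidef`).

For (b) ⇒ (a), test (b) on `x + s • h`, where `h` is a truncated and recentred block-linear
functional. The second-order term as `s → 0` must be nonnegative, and removing the truncation gives
the quadratic form (`posSemidef_of_jensen`). -/

namespace GaussianJensen

/-! ### Second-order Taylor estimates with uniform remainder. -/

section Taylor

variable {V : Type*} [NormedAddCommGroup V] [NormedSpace ℝ V]

/-- Second-order Taylor estimate along a segment on which the second derivative varies
by at most `c`. -/
theorem abs_taylor_two_le {J : V → ℝ} {U : Set V} (hU : IsOpen U) (hJ : ContDiffOn ℝ 2 J U)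
    {x y : V} (hseg : segment ℝ x y ⊆ U) {c : ℝ}
    (hc : ∀ z ∈ segment ℝ x y, ‖fderiv ℝ (fderiv ℝ J) z - fderiv ℝ (fderiv ℝ J) x‖ ≤ c) :
    |J y - J x - fderiv ℝ J x (y - x) - (1 / 2) * fderiv ℝ (fderiv ℝ J) x (y - x) (y - x)|
      ≤ c * ‖y - x‖ ^ 2 := by
  have hxs : x ∈ segment ℝ x y := left_mem_segment ℝ x y
  have hys : y ∈ segment ℝ x y := right_mem_segment ℝ x y
  have hc0 : 0 ≤ c := le_trans (by positivity) (hc x hxs)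
  have hdiff : ∀ z ∈ segment ℝ x y, ContDiffAt ℝ 2 J z := fun z hz =>
    hJ.contDiffAt (hU.mem_nhds (hseg hz))
  have h1 : ∀ z ∈ segment ℝ x y, HasFDerivAt J (fderiv ℝ J z) z := fun z hz =>
    ((hdiff z hz).differentiableAt (by norm_num)).hasFDerivAt
  have h2 : ∀ z ∈ segment ℝ x y, HasFDerivAt (fderiv ℝ J) (fderiv ℝ (fderiv ℝ J) z) z :=
    fun z hz => (((hdiff z hz).fderiv_right (m := 1) (by norm_num)).differentiableAt
      (by norm_num)).hasFDerivAt
  set B := fderiv ℝ (fderiv ℝ J) x with hB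
  have hsymm : ∀ v w, B v w = B w v := fun v w =>
    ((hdiff x hxs).isSymmSndFDerivAt (by simp)) v w
  -- The mean value inequality is used twice: on `fderiv ℝ J` minus its linearization, then on `J`
  -- minus its quadratic Taylor polynomial. This gives `c` instead of the sharp `c / 2`, which
  -- suffices.
  have hfirst : ∀ z ∈ segment ℝ x y, ‖fderiv ℝ J z - fderiv ℝ J x - B (z - x)‖ ≤ c * ‖y - x‖ := by
    intro z hz
    have := (convex_segment x y).norm_image_sub_le_of_norm_hasFDerivWithin_le
      (f := fun z => fderiv ℝ J z - B z) (f' := fun z => fderiv ℝ (fderiv ℝ J) z - B)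
      (fun z hz => ((h2 z hz).sub B.hasFDerivAt).hasFDerivWithinAt) hc hxs hz
    have hzx : ‖z - x‖ ≤ ‖y - x‖ := by
      obtain ⟨θ, hθ, rfl⟩ := segment_eq_image' ℝ x y ▸ hz
      rw [add_sub_cancel_left, norm_smul, Real.norm_of_nonneg hθ.1]
      exact mul_le_of_le_one_left (norm_nonneg _) hθ.2
    calc _ = ‖fderiv ℝ J z - B z - (fderiv ℝ J x - B x)‖ := by rw [map_sub]; congr 1; abel
      _ ≤ c * ‖z - x‖ := this
      _ ≤ _ := by gcongr
  have key := (convex_segment x y).norm_image_sub_le_of_norm_hasFDerivWithin_le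
      (f := fun z => J z - fderiv ℝ J x z - (1 / 2 : ℝ) * B (z - x) (z - x))
      (f' := fun z => fderiv ℝ J z - fderiv ℝ J x - B (z - x))
      (fun z hz => by
        have hq : HasFDerivAt (fun z => (1 / 2 : ℝ) * B (z - x) (z - x)) (B (z - x)) z := by
          have hid : HasFDerivAt (fun z : V => z - x) (ContinuousLinearMap.id ℝ V) z :=
            (hasFDerivAt_id z).sub_const x
          have := ((B.hasFDerivAt.comp z hid).clm_apply hid).const_mul (1 / 2 : ℝ)
          refine this.congr_fderiv ?_
          ext v
          simp [hsymm v z, hsymm v x]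
          ring
        exact (((h1 z hz).sub (fderiv ℝ J x).hasFDerivAt).sub hq).hasFDerivWithinAt)
      hfirst hxs hys
  rw [Real.norm_eq_abs] at key
  calc _ = |J y - fderiv ℝ J x y - (1 / 2 : ℝ) * B (y - x) (y - x)
          - (J x - fderiv ℝ J x x - (1 / 2 : ℝ) * B (x - x) (x - x))| := by
        congr 1; simp only [map_sub, sub_self, map_zero]; ring
    _ ≤ _ := key
    _ = _ := by ring

/-- Second-order Taylor expansion, uniformly on a compact convex set. -/
theorem exists_abs_taylor_two_le {J : V → ℝ} {U K : Set V} (hU : IsOpen U)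
    (hJ : ContDiffOn ℝ 2 J U) (hK : IsCompact K) (hKc : Convex ℝ K) (hKU : K ⊆ U)
    {ε : ℝ} (hε : 0 < ε) :
    ∃ C, 0 ≤ C ∧ ∀ x ∈ K, ∀ y ∈ K,
      |J y - J x - fderiv ℝ J x (y - x) - (1 / 2) * fderiv ℝ (fderiv ℝ J) x (y - x) (y - x)|
        ≤ ε * ‖y - x‖ ^ 2 + C * ‖y - x‖ ^ 3 := by
  have hcont : ContinuousOn (fderiv ℝ (fderiv ℝ J)) K :=
    ((hJ.fderiv_of_isOpen hU (m := 1) (by norm_num)).continuousOn_fderiv_of_isOpen hU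
      (by norm_num)).mono hKU
  obtain ⟨M, hM⟩ := hK.exists_bound_of_continuousOn (E := V →L[ℝ] V →L[ℝ] ℝ) hcont
  obtain ⟨δ, hδ, hδK⟩ := (Metric.uniformContinuousOn_iff (β := V →L[ℝ] V →L[ℝ] ℝ)).1
    (hK.uniformContinuousOn_of_continuous (β := V →L[ℝ] V →L[ℝ] ℝ) hcont) ε hε
  -- For `‖y - x‖ ≥ δ` the second derivative varies by at most `2 * |M|`, and `‖y - x‖ ^ 2 ≤ ‖y - x‖
  -- ^ 3 / δ`. The cubic term handles large increments through their third moment.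
  refine ⟨2 * |M| / δ, by positivity, fun x hx y hy => ?_⟩
  have hseg := hKc.segment_subset hx hy
  by_cases hlt : ‖y - x‖ < δ
  · refine (abs_taylor_two_le hU hJ (hseg.trans hKU) (c := ε) fun z hz => ?_).trans
      (le_add_of_nonneg_right (by positivity))
    refine (dist_eq_norm (E := V →L[ℝ] V →L[ℝ] ℝ) _ _).symm.le.trans
      (hδK z (hseg hz) x hx ?_).le
    obtain ⟨θ, hθ, rfl⟩ := segment_eq_image' ℝ x y ▸ hz
    rw [dist_eq_norm, add_sub_cancel_left, norm_smul, Real.norm_of_nonneg hθ.1]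
    exact (mul_le_of_le_one_left (norm_nonneg _) hθ.2).trans_lt hlt
  · refine (abs_taylor_two_le hU hJ (hseg.trans hKU) (c := 2 * |M|) fun z hz => ?_).trans
      (le_add_of_nonneg_of_le (by positivity) ?_)
    · have := (norm_sub_le (fderiv ℝ (fderiv ℝ J) z) (fderiv ℝ (fderiv ℝ J) x)).trans
        (add_le_add (hM z (hseg hz)) (hM x hx))
      linarith [le_abs_self M]
    · rw [div_mul_eq_mul_div, le_div_iff₀ hδ, pow_succ _ 2, ← mul_assoc]
      gcongr
      exact not_lt.1 hlt

end Taylor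

/-- `J` may fail to be measurable off `K`, so `f` is factored through the subtype `K`. -/
theorem integrable_comp_of_continuousOn {S W : Type*} [MeasurableSpace S] {ν : Measure S}
    [IsFiniteMeasure ν] [TopologicalSpace W] [MeasurableSpace W] [BorelSpace W]
    {J : W → ℝ} {K : Set W} (hJ : ContinuousOn J K) {C : ℝ} (hC : ∀ x ∈ K, |J x| ≤ C)
    {f : S → W} (hf : Measurable f) (hfK : ∀ s, f s ∈ K) :
    Integrable (fun s => J (f s)) ν :=
  Integrable.of_bound (((continuousOn_iff_continuous_domRestrict.1 hJ).measurable.comp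
    (hf.subtype_mk (h := hfK))).aestronglyMeasurable) C (.of_forall fun s => hC _ (hfK s))

/-! ### A class of functions stable under averaging. -/

section QuadApprox

open scoped InnerProductSpace

/-- `G` is a bounded measurable field of first-order approximations of `F`, with a uniform
quadratic error. -/
structure QuadApprox {V : Type*} [NormedAddCommGroup V] [InnerProductSpace ℝ V]
    [MeasurableSpace V] (L : ℝ) (F : V → ℝ) (G : V → V) : Prop where
  measurable : Measurable F
  measurable_grad : Measurable G
  norm_le : ∀ y, ‖G y‖ ≤ L
  approx : ∀ y h, |F (y + h) - F y - ⟪G y, h⟫_ℝ| ≤ L * ‖h‖ ^ 2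

variable {V : Type*} [NormedAddCommGroup V] [InnerProductSpace ℝ V] [FiniteDimensional ℝ V]
  [MeasurableSpace V] [BorelSpace V] {S : Type*} [MeasurableSpace S] {ν : Measure S}
  [IsProbabilityMeasure ν]

theorem integral_mem_Icc {f : S → ℝ} (hf : Measurable f) {a b : ℝ}
    (hb : ∀ s, f s ∈ Set.Icc a b) : ∫ s, f s ∂ν ∈ Set.Icc a b :=
  (convex_Icc a b).integral_mem isClosed_Icc (.of_forall hb)
    (Integrable.of_mem_Icc a b hf.aemeasurable (.of_forall hb))

/-- Averages over translations preserve `QuadApprox`. -/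
theorem QuadApprox.average {L a b : ℝ} {F : V → ℝ} {G : V → V} (h : QuadApprox L F G)
    (hb : ∀ y, F y ∈ Set.Icc a b) {T : S → V} (hT : Measurable T) :
    QuadApprox L (fun y => ∫ s, F (y + T s) ∂ν) (fun y => ∫ s, G (y + T s) ∂ν) := by
  have hFi : ∀ y, Integrable (fun s => F (y + T s)) ν := fun y =>
    Integrable.of_mem_Icc a b (h.measurable.comp (hT.const_add y)).aemeasurable
      (.of_forall fun s => hb _)
  have hGi : ∀ y, Integrable (fun s => G (y + T s)) ν := fun y =>
    Integrable.of_bound (h.measurable_grad.comp (hT.const_add y)).aestronglyMeasurable L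
      (.of_forall fun s => h.norm_le _)
  have hadd : Measurable fun p : V × S => p.1 + T p.2 :=
    measurable_fst.add (hT.comp measurable_snd)
  refine ⟨?_, ?_, fun y => ?_, fun y v => ?_⟩
  · exact (StronglyMeasurable.integral_prod_right
      (f := fun y s => F (y + T s)) (h.measurable.comp hadd).stronglyMeasurable).measurable
  · exact (StronglyMeasurable.integral_prod_right
      (f := fun y s => G (y + T s)) (h.measurable_grad.comp hadd).stronglyMeasurable).measurable
  · simpa using norm_integral_le_of_norm_le_const (μ := ν)
      (.of_forall fun s => h.norm_le (y + T s))
  · have hsub : Integrable (fun s => F (y + v + T s) - F (y + T s)) ν := (hFi _).sub (hFi _)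
    rw [real_inner_comm, ← integral_inner (hGi y), ← integral_sub (hFi _) (hFi _),
      ← integral_sub hsub ((hGi y).const_inner v), ← Real.norm_eq_abs]
    refine (norm_integral_le_of_norm_le_const (C := L * ‖v‖ ^ 2)
      (.of_forall fun s => ?_)).trans (by simp)
    rw [Real.norm_eq_abs, real_inner_comm, add_right_comm]
    exact h.approx _ _

end QuadApprox

/-! ### Jensen's inequality for one small increment, up to `ε * r ^ 2`. -/

section OneStep

open scoped InnerProductSpace

/-- Write `v = r • w + u` and expand. Each of the two cross terms costs at most `M * r ^ 3 * c ^ 2`,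
and `B u u` costs `M * r ^ 4 * c ^ 2`, no more since `r ≤ 1`; hence the factor 3. -/
theorem apply_apply_ge_of_norm_sub_le {W : Type*} [NormedAddCommGroup W] [NormedSpace ℝ W]
    (B : W →L[ℝ] W →L[ℝ] ℝ) {M r c : ℝ} (hM : ‖B‖ ≤ M) (hr0 : 0 ≤ r) (hr1 : r ≤ 1)
    {v w : W} (hw : ‖w‖ ≤ c) (hvw : ‖v - r • w‖ ≤ r ^ 2 * c) :
    r ^ 2 * B w w - 3 * M * r ^ 3 * c ^ 2 ≤ B v v := by
  have hc : 0 ≤ c := (norm_nonneg w).trans hw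
  have hM0 : 0 ≤ M := le_trans (by positivity) hM
  set u := v - r • w with hu
  have hv : v = r • w + u := by simp [hu]
  have hB : ∀ x y : W, ∀ p q : ℝ, ‖x‖ ≤ p → ‖y‖ ≤ q → 0 ≤ p → -(M * p * q) ≤ B x y := by
    intro x y p q hx hy hp
    have := B.le_opNorm₂ x y
    have h2 : ‖B‖ * ‖x‖ * ‖y‖ ≤ M * p * q := by gcongr
    exact (abs_le.1 (this.trans h2)).1
  have e1 := hB w u _ _ hw hvw hc
  have e2 := hB u w _ _ hvw hw (by positivity)
  have e3 := hB u u _ _ hvw hvw (by positivity)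
  have hexp : B v v = r ^ 2 * B w w + (r * B w u + r * B u w + B u u) := by
    rw [hv]; simp; ring
  rw [hexp]
  have e1' := mul_le_mul_of_nonneg_left e1 hr0
  have e2' := mul_le_mul_of_nonneg_left e2 hr0
  have e4 : r ^ 4 * (M * c ^ 2) ≤ r ^ 3 * (M * c ^ 2) :=
    mul_le_mul_of_nonneg_right (pow_le_pow_of_le_one hr0 hr1 (by norm_num)) (by positivity)
  nlinarith

variable {k : ℕ} {V : Fin k → Type*} [∀ i, NormedAddCommGroup (V i)]
  [∀ i, InnerProductSpace ℝ (V i)] [∀ i, FiniteDimensional ℝ (V i)]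
  [∀ i, MeasurableSpace (V i)] [∀ i, BorelSpace (V i)]
  {E : Type*} [NormedAddCommGroup E] [NormedSpace ℝ E] [FiniteDimensional ℝ E]
  [MeasurableSpace E] [BorelSpace E]

/-- The linear part has mean zero, so the mean of `F` differs from `F y` only by `O(r ^ 2)`. The
expansion can therefore be centred at the mean, where the linear term of `J` will vanish. -/
theorem abs_sub_integral_sub_le {V : Type*} [NormedAddCommGroup V] [InnerProductSpace ℝ V]
    [FiniteDimensional ℝ V] [MeasurableSpace V] [BorelSpace V]
    {μ : Measure E} [IsProbabilityMeasure μ]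
    (hmom : ∀ p : ℕ, Integrable (fun z => ‖z‖ ^ p) μ)
    (hmean : ∀ ℓ : E →L[ℝ] ℝ, ∫ z, ℓ z ∂μ = 0)
    (T : E →L[ℝ] V) (hT : ∀ z, ‖T z‖ ≤ ‖z‖) {L a b : ℝ} {F : V → ℝ} {G : V → V}
    (h : QuadApprox L F G) (hb : ∀ y, F y ∈ Set.Icc a b) (y : V) (r : ℝ) (z : E) :
    |F (y + r • T z) - ∫ w, F (y + r • T w) ∂μ - r * ⟪G y, T z⟫_ℝ| ≤
      r ^ 2 * (L * (‖z‖ ^ 2 + ∫ w, ‖w‖ ^ 2 ∂μ)) := by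
  have hL : 0 ≤ L := (norm_nonneg _).trans (h.norm_le y)
  have hpt : ∀ w, |F (y + r • T w) - F y - r * ⟪G y, T w⟫_ℝ| ≤ r ^ 2 * L * ‖w‖ ^ 2 := by
    intro w
    rw [← real_inner_smul_right]
    refine (h.approx _ _).trans ?_
    rw [norm_smul, mul_pow, Real.norm_eq_abs, sq_abs, mul_left_comm, ← mul_assoc]
    gcongr
    exact hT w
  have hF : Integrable (fun w => F (y + r • T w)) μ :=
    Integrable.of_mem_Icc a b (h.measurable.comp (by fun_prop)).aemeasurable
      (.of_forall fun _ => hb _)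
  let ℓ : E →L[ℝ] ℝ := (innerSL ℝ (G y)).comp T
  have hℓi : Integrable (fun w => ℓ w) μ :=
    ℓ.integrable_comp ((integrable_norm_iff (by fun_prop)).1 (by simpa using hmom 1))
  have hint : |∫ w, F (y + r • T w) ∂μ - F y| ≤ r ^ 2 * L * ∫ w, ‖w‖ ^ 2 ∂μ := by
    have e : ∫ w, (F (y + r • T w) - F y - r * ℓ w) ∂μ = ∫ w, F (y + r • T w) ∂μ - F y := by
      have hsub : Integrable (fun w => F (y + r • T w) - F y) μ := hF.sub (integrable_const _)
      rw [integral_sub hsub (hℓi.const_mul r),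
        integral_sub hF (integrable_const _), integral_const_mul, hmean]
      simp
    rw [← e, ← Real.norm_eq_abs, ← integral_const_mul]
    exact norm_integral_le_of_norm_le ((hmom 2).const_mul _) (.of_forall hpt)
  have e : F (y + r • T z) - ∫ w, F (y + r • T w) ∂μ - r * ⟪G y, T z⟫_ℝ =
    (F (y + r • T z) - F y - r * ⟪G y, T z⟫_ℝ) - (∫ w, F (y + r • T w) ∂μ - F y) := by ring
  rw [e]
  refine (abs_sub _ _).trans ((add_le_add (hpt z) hint).trans (le_of_eq (by ring)))

-- The point is uniformity: `δ` does not depend on `F`, `G` or `y`, only on `L`, `ε` and the fixed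
-- data, so the same `r` serves at every stage of the iteration.
set_option maxHeartbeats 1000000 in
theorem exists_jensen_one_step {μ : Measure E} [IsProbabilityMeasure μ]
    (hmom : ∀ p : ℕ, Integrable (fun z => ‖z‖ ^ p) μ)
    (hmean : ∀ ℓ : E →L[ℝ] ℝ, ∫ z, ℓ z ∂μ = 0)
    (T : ∀ i, E →L[ℝ] V i) (hT : ∀ i z, ‖T i z‖ ≤ ‖z‖)
    {J : (Fin k → ℝ) → ℝ} {U : Set (Fin k → ℝ)} (hU : IsOpen U) (hJ : ContDiffOn ℝ 2 J U)
    {a b : Fin k → ℝ} (hK : Set.Icc a b ⊆ U)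
    (hpos : ∀ m ∈ Set.Icc a b, ∀ g : ∀ i, V i,
      0 ≤ ∫ z, fderiv ℝ (fderiv ℝ J) m (fun i => ⟪g i, T i z⟫_ℝ) (fun i => ⟪g i, T i z⟫_ℝ) ∂μ)
    {L : ℝ} (hL : 0 ≤ L) {ε : ℝ} (hε : 0 < ε) :
    ∃ δ > 0, ∀ r, 0 < r → r < δ → ∀ (F : ∀ i, V i → ℝ) (G : ∀ i, V i → V i),
      (∀ i, QuadApprox L (F i) (G i)) → (∀ i y, F i y ∈ Set.Icc (a i) (b i)) → ∀ y : ∀ i, V i,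
      J (fun i => ∫ z, F i (y i + r • T i z) ∂μ) ≤
        ∫ z, J (fun i => F i (y i + r • T i z)) ∂μ + ε * r ^ 2 := by
  set M₂ := ∫ w, ‖w‖ ^ 2 ∂μ with hM₂
  have hM₂0 : 0 ≤ M₂ := integral_nonneg fun _ => by positivity
  -- One majorant for both sizes: `‖z‖` controls the linear part `w`, and `‖z‖ ^ 2 + M₂` controls
  -- the quadratic error.
  set Q : E → ℝ := fun z => ‖z‖ + ‖z‖ ^ 2 + M₂ with hQ
  have hQ0 : ∀ z, 0 ≤ Q z := fun z => by positivity
  have hQm : ∀ p : ℕ, MemLp Q p μ := by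
    have hn : ∀ q : ℕ, ∀ p : ℕ, MemLp (fun z : E => ‖z‖ ^ q) p μ := by
      intro q p
      rcases eq_or_ne p 0 with rfl | hp
      · simpa using memLp_zero_iff_aestronglyMeasurable.2
          (by fun_prop : AEStronglyMeasurable (fun z : E => ‖z‖ ^ q) μ)
      rw [← integrable_norm_rpow_iff (by fun_prop) (by simpa using hp) (by simp)]
      refine (hmom (q * p)).congr (.of_forall fun z => ?_)
      simp [pow_mul]
    intro p
    have h1 := hn 1 p
    simp only [pow_one] at h1
    exact (h1.add (hn 2 p)).add (memLp_const M₂)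
  have hQi : ∀ p : ℕ, Integrable (fun z => Q z ^ p) μ := fun p => by
    refine ((hQm p).integrable_norm_pow').congr (.of_forall fun z => ?_)
    simp [abs_of_nonneg (hQ0 z)]
  set I₂ := ∫ z, Q z ^ 2 ∂μ with hI₂
  set I₃ := ∫ z, Q z ^ 3 ∂μ with hI₃
  have hI₂0 : 0 ≤ I₂ := integral_nonneg fun z => by have := hQ0 z; positivity
  have hI₃0 : 0 ≤ I₃ := integral_nonneg fun z => by have := hQ0 z; positivity
  have hJc : ContinuousOn J (Set.Icc a b) := hJ.continuousOn.mono hK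
  have hcont : ContinuousOn (fderiv ℝ (fderiv ℝ J)) (Set.Icc a b) :=
    ((hJ.fderiv_of_isOpen hU (m := 1) (by norm_num)).continuousOn_fderiv_of_isOpen hU
      (by norm_num)).mono hK
  obtain ⟨M', hM'⟩ := isCompact_Icc.exists_bound_of_continuousOn
    (E := (Fin k → ℝ) →L[ℝ] (Fin k → ℝ) →L[ℝ] ℝ) hcont
  set M := |M'| with hMdef
  have hM : ∀ m ∈ Set.Icc a b, ‖fderiv ℝ (fderiv ℝ J) m‖ ≤ M := fun m hm =>
    (hM' m hm).trans (le_abs_self _)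
  have hM0 : 0 ≤ M := abs_nonneg _
  -- Chosen so that the quadratic remainder `4 * ε' * L ^ 2 * I₂` is at most `ε / 2`. The cubic
  -- terms add up to `r ^ 3 * N`, and the bound on `r` below gives `r * N ≤ ε / 2`.
  set ε' := ε / (8 * (L ^ 2 * I₂ + 1)) with hε'
  obtain ⟨C, hC0, hC⟩ := exists_abs_taylor_two_le hU hJ isCompact_Icc (convex_Icc a b) hK
    (ε := ε') (by positivity)
  set N := (3 / 2) * M * L ^ 2 * I₂ + 8 * C * L ^ 3 * I₃ with hN
  have hN0 : 0 ≤ N := by positivity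
  refine ⟨min 1 (ε / (2 * (N + 1))), by positivity, fun r hr0 hrδ F G hFG hFb y => ?_⟩
  have hr1 : r ≤ 1 := (hrδ.trans_le (min_le_left _ _)).le
  have hr2 : r * (2 * (N + 1)) ≤ ε :=
    (le_div_iff₀ (by positivity)).1 (hrδ.trans_le (min_le_right _ _)).le
  set f : E → Fin k → ℝ := fun z i => F i (y i + r • T i z) with hf
  set m : Fin k → ℝ := fun i => ∫ z, F i (y i + r • T i z) ∂μ with hm
  set w : E → Fin k → ℝ := fun z i => ⟪G i (y i), T i z⟫_ℝ with hw
  have hfm : Measurable f := measurable_pi_lambda _ fun i =>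
    (hFG i).measurable.comp (by fun_prop)
  have hfK : ∀ z, f z ∈ Set.Icc a b := fun z => ⟨fun i => (hFb i _).1, fun i => (hFb i _).2⟩
  have hmi : ∀ i, m i ∈ Set.Icc (a i) (b i) := fun i =>
    integral_mem_Icc (measurable_pi_iff.1 hfm i) fun z => hFb i _
  have hmK : m ∈ Set.Icc a b := ⟨fun i => (hmi i).1, fun i => (hmi i).2⟩
  have hfint : Integrable f μ := Integrable.of_eval fun i =>
    Integrable.of_mem_Icc (a i) (b i) (measurable_pi_iff.1 hfm i).aemeasurable
      (.of_forall fun z => hFb i _)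
  have hfmean : ∫ z, f z ∂μ = m := by
    ext i
    rw [eval_integral fun i => hfint.eval i]
  have hJfint : Integrable (fun z => J (f z)) μ := by
    obtain ⟨c, hc⟩ := isCompact_Icc.exists_bound_of_continuousOn hJc
    exact integrable_comp_of_continuousOn hJc hc hfm hfK
  have hwn : ∀ z, ‖w z‖ ≤ L * Q z := by
    intro z
    refine (pi_norm_le_iff_of_nonneg (by have := hQ0 z; positivity)).2 fun i => ?_
    calc ‖w z i‖ ≤ ‖G i (y i)‖ * ‖T i z‖ := norm_inner_le_norm _ _
      _ ≤ L * ‖z‖ := by gcongr; exacts [(hFG i).norm_le _, hT i z]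
      _ ≤ L * Q z := by
        gcongr
        have : 0 ≤ ‖z‖ ^ 2 + M₂ := by positivity
        simp only [hQ]; linarith
  have hfw : ∀ z, ‖(f z - m) - r • w z‖ ≤ r ^ 2 * (L * Q z) := by
    intro z
    refine (pi_norm_le_iff_of_nonneg (by have := hQ0 z; positivity)).2 fun i => ?_
    refine (abs_sub_integral_sub_le hmom hmean (T i) (hT i) (hFG i) (hFb i) (y i) r z).trans ?_
    gcongr
    simp only [hQ]; linarith [norm_nonneg z]
  have hfn : ∀ z, ‖f z - m‖ ≤ 2 * r * (L * Q z) := by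
    intro z
    have hc : 0 ≤ L * Q z := by have := hQ0 z; positivity
    calc ‖f z - m‖ = ‖((f z - m) - r • w z) + r • w z‖ := by rw [sub_add_cancel]
      _ ≤ r ^ 2 * (L * Q z) + r * (L * Q z) := by
        refine (norm_add_le _ _).trans (add_le_add (hfw z) ?_)
        rw [norm_smul, Real.norm_of_nonneg hr0.le]
        gcongr
        exact hwn z
      _ ≤ r * (L * Q z) + r * (L * Q z) := by
        gcongr
        exact pow_le_of_le_one hr0.le hr1 two_ne_zero
      _ = _ := by ring
  set B := fderiv ℝ (fderiv ℝ J) m with hB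
  have hpt : ∀ z, J m + fderiv ℝ J m (f z - m) + (1 / 2) * (r ^ 2 * B (w z) (w z))
      - (r ^ 2 * ((4 * ε' * L ^ 2) * Q z ^ 2) + r ^ 3 * ((3 / 2) * M * L ^ 2 * Q z ^ 2
        + 8 * C * L ^ 3 * Q z ^ 3)) ≤ J (f z) := by
    intro z
    have h1 := (abs_le.1 (hC m hmK (f z) (hfK z))).1
    have h2 := apply_apply_ge_of_norm_sub_le B (hM m hmK) hr0.le hr1 (hwn z) (hfw z)
    have h3 : ε' * ‖f z - m‖ ^ 2 ≤ ε' * (2 * r * (L * Q z)) ^ 2 := by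
      gcongr; exact hfn z
    have h4 : C * ‖f z - m‖ ^ 3 ≤ C * (2 * r * (L * Q z)) ^ 3 := by
      gcongr; exact hfn z
    rw [← hB] at h1
    have e2 : (1 / 2) * (r ^ 2 * B (w z) (w z)) ≤
        (1 / 2) * B (f z - m) (f z - m) + (3 / 2) * M * r ^ 3 * (L * Q z) ^ 2 := by linarith
    have e3 : ε' * (2 * r * (L * Q z)) ^ 2 + C * (2 * r * (L * Q z)) ^ 3
        + (3 / 2) * M * r ^ 3 * (L * Q z) ^ 2
        = r ^ 2 * ((4 * ε' * L ^ 2) * Q z ^ 2) + r ^ 3 * ((3 / 2) * M * L ^ 2 * Q z ^ 2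
          + 8 * C * L ^ 3 * Q z ^ 3) := by ring
    linarith
  have hwi : Integrable (fun z => B (w z) (w z)) μ := by
    have hwm : AEStronglyMeasurable (fun z => B (w z) (w z)) μ := by
      have : Continuous w := by
        refine continuous_pi fun i => ?_
        simp only [hw]; fun_prop
      exact Continuous.aestronglyMeasurable (by fun_prop)
    refine ((hQi 2).const_mul (M * L ^ 2)).mono' hwm (.of_forall fun z => ?_)
    calc _ ≤ ‖B‖ * ‖w z‖ * ‖w z‖ := B.le_opNorm₂ _ _
      _ ≤ M * (L * Q z) * (L * Q z) := by
        have := hwn z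
        gcongr
        exact hM m hmK
      _ = _ := by ring
  have hfmi : Integrable (fun z => f z - m) μ := hfint.sub (integrable_const m)
  have hDi : Integrable (fun z => fderiv ℝ J m (f z - m)) μ :=
    (fderiv ℝ J m).integrable_comp hfmi
  have hDz : ∫ z, fderiv ℝ J m (f z - m) ∂μ = 0 := by
    rw [(fderiv ℝ J m).integral_comp_comm hfmi,
      integral_sub hfint (integrable_const m), hfmean]
    simp
  have hi1 : Integrable (fun z => J m + fderiv ℝ J m (f z - m)) μ :=
    (integrable_const _).add hDi
  have hi2 : Integrable (fun z => (1 / 2) * (r ^ 2 * B (w z) (w z))) μ :=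
    (hwi.const_mul _).const_mul _
  have hi3 : Integrable (fun z => r ^ 2 * ((4 * ε' * L ^ 2) * Q z ^ 2)) μ :=
    ((hQi 2).const_mul _).const_mul _
  have hi4 : Integrable (fun z => (3 / 2) * M * L ^ 2 * Q z ^ 2) μ := (hQi 2).const_mul _
  have hi5 : Integrable (fun z => 8 * C * L ^ 3 * Q z ^ 3) μ := (hQi 3).const_mul _
  have hi6 : Integrable (fun z => r ^ 3 * ((3 / 2) * M * L ^ 2 * Q z ^ 2
        + 8 * C * L ^ 3 * Q z ^ 3)) μ := (hi4.add hi5).const_mul _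
  have hi12 : Integrable (fun z => J m + fderiv ℝ J m (f z - m)
      + (1 / 2) * (r ^ 2 * B (w z) (w z))) μ := hi1.add hi2
  have hi36 : Integrable (fun z => r ^ 2 * ((4 * ε' * L ^ 2) * Q z ^ 2)
      + r ^ 3 * ((3 / 2) * M * L ^ 2 * Q z ^ 2 + 8 * C * L ^ 3 * Q z ^ 3)) μ := hi3.add hi6
  have key := integral_mono (hi12.sub hi36) hJfint hpt
  simp only [Pi.sub_apply] at key
  rw [integral_sub hi12 hi36, integral_add hi1 hi2, integral_add hi3 hi6,
    integral_add (integrable_const _) hDi, hDz, integral_const_mul, integral_const_mul,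
    integral_const_mul, integral_const_mul, integral_const_mul, integral_add hi4 hi5,
    integral_const_mul, integral_const_mul, integral_const, ← hI₂, ← hI₃, ← hN] at key
  simp only [probReal_univ, smul_eq_mul, one_mul, add_zero] at key
  have hp := hpos m hmK fun i => G i (y i)
  have h1 : 4 * ε' * L ^ 2 * I₂ ≤ ε / 2 := by
    have : ε' * (8 * (L ^ 2 * I₂ + 1)) = ε := by rw [hε']; field_simp
    have : 0 ≤ ε' := by positivity
    nlinarith
  have h2 : r * N ≤ ε / 2 := by nlinarith
  have h3 : r ^ 2 * (4 * ε' * L ^ 2 * I₂) + r ^ 3 * N ≤ ε * r ^ 2 := by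
    have := mul_le_mul_of_nonneg_left (add_le_add h1 h2) (sq_nonneg r)
    nlinarith
  have h4 : 0 ≤ (1 / 2 : ℝ) * (r ^ 2 * ∫ z, B (w z) (w z) ∂μ) := by positivity
  linarith

end OneStep

/-! ### Iteration along a random walk. -/

section Iterate

variable {k : ℕ} {V : Fin k → Type*} [∀ i, NormedAddCommGroup (V i)]
  [∀ i, InnerProductSpace ℝ (V i)] [∀ i, FiniteDimensional ℝ (V i)]
  [∀ i, MeasurableSpace (V i)] [∀ i, BorelSpace (V i)]
  {E : Type*} [NormedAddCommGroup E] [NormedSpace ℝ E] [FiniteDimensional ℝ E]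
  [MeasurableSpace E] [BorelSpace E]

/-- `κ n` is the law of the walk after `n` steps. Averaging `F` over the last increment gives `F'`,
still in the class with the same `L`. The induction hypothesis treats `F'`, and one step, applied at
each position of the walk, passes from `F'` to `F`. -/
theorem jensen_iterate {ν : Measure E} [IsProbabilityMeasure ν]
    {κ : ℕ → Measure E} (hκp : ∀ n, IsProbabilityMeasure (κ n)) (hκ0 : κ 0 = Measure.dirac 0)
    (hκ : ∀ n, κ (n + 1) = κ n ∗ ν) (T : ∀ i, E →L[ℝ] V i)
    {J : (Fin k → ℝ) → ℝ} {a b : Fin k → ℝ} (hJ : ContinuousOn J (Set.Icc a b)) {L e : ℝ}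
    (hstep : ∀ (F : ∀ i, V i → ℝ) (G : ∀ i, V i → V i),
      (∀ i, QuadApprox L (F i) (G i)) → (∀ i y, F i y ∈ Set.Icc (a i) (b i)) → ∀ y : ∀ i, V i,
      J (fun i => ∫ z, F i (y i + T i z) ∂ν) ≤ ∫ z, J (fun i => F i (y i + T i z)) ∂ν + e)
    (n : ℕ) (F : ∀ i, V i → ℝ) (G : ∀ i, V i → V i) (hFG : ∀ i, QuadApprox L (F i) (G i))
    (hFb : ∀ i y, F i y ∈ Set.Icc (a i) (b i)) :
    J (fun i => ∫ z, F i (T i z) ∂κ n) ≤ ∫ z, J (fun i => F i (T i z)) ∂κ n + n * e := by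
  obtain ⟨C, hC⟩ := isCompact_Icc.exists_bound_of_continuousOn hJ
  have hJint : ∀ (ρ : Measure E) [IsProbabilityMeasure ρ] (F : ∀ i, V i → ℝ),
      (∀ i, Measurable (F i)) → (∀ i y, F i y ∈ Set.Icc (a i) (b i)) →
      Integrable (fun z => J (fun i => F i (T i z))) ρ := fun ρ _ F hF hFb =>
    integrable_comp_of_continuousOn hJ hC
      (measurable_pi_lambda _ fun i => (hF i).comp (by fun_prop))
      fun z => ⟨fun i => (hFb i _).1, fun i => (hFb i _).2⟩
  have hFint : ∀ (ρ : Measure E) [IsProbabilityMeasure ρ] (F : ∀ i, V i → ℝ),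
      (∀ i, Measurable (F i)) → (∀ i y, F i y ∈ Set.Icc (a i) (b i)) → ∀ i,
      Integrable (fun z => F i (T i z)) ρ := fun ρ _ F hF hFb i =>
    Integrable.of_mem_Icc (a i) (b i) ((hF i).comp (by fun_prop)).aemeasurable
      (.of_forall fun _ => hFb i _)
  induction n generalizing F G with
  | zero =>
    rw [hκ0]
    simp
  | succ n ih =>
    have := hκp n
    have := hκp (n + 1)
    have hFm := fun i => (hFG i).measurable
    set F' : ∀ i, V i → ℝ := fun i y => ∫ z, F i (y + T i z) ∂ν with hF'
    have hFG' : ∀ i, QuadApprox L (F' i) (fun y => ∫ z, G i (y + T i z) ∂ν) := fun i =>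
      (hFG i).average (hFb i) (by fun_prop)
    have hFb' : ∀ i y, F' i y ∈ Set.Icc (a i) (b i) := fun i y =>
      integral_mem_Icc ((hFm i).comp (by fun_prop)) fun _ => hFb i _
    have hconvF : ∀ i, ∫ z, F i (T i z) ∂κ (n + 1) = ∫ z, F' i (T i z) ∂κ n := by
      intro i
      have hi := hFint (κ (n + 1)) F hFm hFb i
      rw [hκ] at hi ⊢
      rw [integral_conv hi]
      simp only [map_add, hF']
    have hi := hJint (κ (n + 1)) F hFm hFb
    have hconvJ : ∫ z, J (fun i => F i (T i z)) ∂κ (n + 1) =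
        ∫ x, ∫ z, J (fun i => F i (T i x + T i z)) ∂ν ∂κ n := by
      rw [hκ] at hi ⊢
      rw [integral_conv hi]
      simp only [map_add]
    have hi2 : Integrable (fun x => ∫ z, J (fun i => F i (T i x + T i z)) ∂ν) (κ n) := by
      rw [hκ] at hi
      have h2 := ((integrable_conv_iff hi.aestronglyMeasurable).1 hi).2
      have hm : AEStronglyMeasurable (fun p : E × E => J (fun i => F i (T i p.1 + T i p.2)))
          ((κ n).prod ν) := by
        refine (integrable_comp_of_continuousOn (ν := (κ n).prod ν) hJ hC
          (measurable_pi_lambda _ fun i => (hFm i).comp (by fun_prop))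
          fun z => ⟨fun i => (hFb i _).1, fun i => (hFb i _).2⟩).aestronglyMeasurable
      refine Integrable.of_bound hm.integral_prod_right' C (.of_forall fun x => ?_)
      refine (norm_integral_le_of_norm_le_const (C := C) (.of_forall fun z => ?_)).trans (by simp)
      exact hC _ ⟨fun i => (hFb i _).1, fun i => (hFb i _).2⟩
    have h1 := ih F' _ hFG' hFb'
    have h2 : ∫ x, J (fun i => F' i (T i x)) ∂κ n ≤
        ∫ x, (∫ z, J (fun i => F i (T i x + T i z)) ∂ν + e) ∂κ n :=
      integral_mono (hJint (κ n) F' (fun i => (hFG' i).measurable) hFb')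
        (hi2.add (integrable_const e)) fun x => hstep F G hFG hFb fun i => T i x
    rw [integral_add hi2 (integrable_const e)] at h2
    simp only [integral_const, probReal_univ, smul_eq_mul, one_mul] at h2
    simp only [hconvF, hconvJ]
    push_cast
    linarith

end Iterate

/-! ### Gaussian convolution, moments, and Jensen's inequality on the stable class. -/

section Gaussian

open scoped InnerProductSpace

/-- The exponents `-c ^ 2 * (xᵀ A x) / 2` of the characteristic functions add; this covers
degenerate `A`. -/
theorem map_smul_multivariateGaussian_conv {ι : Type*} [Fintype ι] [DecidableEq ι]
    {A : Matrix ι ι ℝ} (hA : A.PosSemidef) {s t u : ℝ} (h : s ^ 2 + t ^ 2 = u ^ 2) :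
    (multivariateGaussian 0 A).map (s • ·) ∗ (multivariateGaussian 0 A).map (t • ·) =
      (multivariateGaussian 0 A).map (u • ·) := by
  have hp : ∀ c : ℝ, IsProbabilityMeasure ((multivariateGaussian 0 A).map (c • ·)) := fun c =>
    Measure.isProbabilityMeasure_map (by fun_prop)
  have := hp s
  have := hp t
  have := hp u
  apply Measure.ext_of_charFun
  ext x
  rw [charFun_conv, charFun_map_smul, charFun_map_smul, charFun_map_smul,
    charFun_multivariateGaussian hA, charFun_multivariateGaussian hA,
    charFun_multivariateGaussian hA, ← Complex.exp_add]
  congr 1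
  simp only [inner_zero_right, WithLp.ofLp_smul, Matrix.mulVec_smul,
    smul_dotProduct, dotProduct_smul, smul_eq_mul]
  push_cast
  have h' : (s : ℂ) ^ 2 + (t : ℂ) ^ 2 = (u : ℂ) ^ 2 := by exact_mod_cast h
  linear_combination (-((x.ofLp ⬝ᵥ A *ᵥ x.ofLp : ℝ) : ℂ) / 2) * h'

theorem integrable_norm_pow_gaussian {E : Type*} [NormedAddCommGroup E] [NormedSpace ℝ E]
    [FiniteDimensional ℝ E] [MeasurableSpace E] [BorelSpace E] (μ : Measure E) [IsGaussian μ]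
    (p : ℕ) : Integrable (fun z => ‖z‖ ^ p) μ :=
  (IsGaussian.memLp_id μ p (by simp)).integrable_norm_pow'

theorem memLp_apply_multivariateGaussian {ι : Type*} [Fintype ι] [DecidableEq ι]
    (A : Matrix ι ι ℝ) (p : ι) :
    MemLp (fun z : EuclideanSpace ℝ ι => z p) 2 (multivariateGaussian 0 A) :=
  (IsGaussian.memLp_two_id (μ := multivariateGaussian 0 A)).continuousLinearMap_comp
    (EuclideanSpace.proj (𝕜 := ℝ) p)

theorem integral_mul_multivariateGaussian {ι : Type*} [Fintype ι] [DecidableEq ι]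
    {A : Matrix ι ι ℝ} (hA : A.PosSemidef) (p q : ι) :
    ∫ z, z p * z q ∂multivariateGaussian 0 A = A p q := by
  have hz : ∀ p : ι, ∫ z, z p ∂multivariateGaussian 0 A = 0 := fun p => by
    have := (EuclideanSpace.proj (𝕜 := ℝ) p).integral_comp_comm
      (μ := multivariateGaussian 0 A) (φ := fun z => z) IsGaussian.integrable_fun_id
    simpa using this
  have := covariance_eq_sub (memLp_apply_multivariateGaussian A p)
    (memLp_apply_multivariateGaussian A q)
  rw [covariance_eval_multivariateGaussian hA, hz, hz] at this
  simpa using this.symm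

/-- The block projection as a continuous linear map. -/
noncomputable def blockProjL {k : ℕ} (d : Fin k → ℕ) (i : Fin k) :
    EuclideanSpace ℝ (BlockIndex d) →L[ℝ] EuclideanSpace ℝ (Fin (d i)) :=
  LinearMap.toContinuousLinearMap
    { toFun := blockProj d i
      map_add' := fun _ _ => rfl
      map_smul' := fun _ _ => rfl }

variable {k : ℕ} {d : Fin k → ℕ}

@[simp]
theorem blockProjL_apply (i : Fin k) (x : EuclideanSpace ℝ (BlockIndex d)) :
    blockProjL d i x = blockProj d i x := rfl

theorem norm_blockProj_le (i : Fin k) (x : EuclideanSpace ℝ (BlockIndex d)) :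
    ‖blockProj d i x‖ ≤ ‖x‖ := by
  rw [EuclideanSpace.norm_eq, EuclideanSpace.norm_eq, Fintype.sum_sigma]
  refine Real.sqrt_le_sqrt ?_
  exact Finset.single_le_sum (f := fun i => ∑ j, ‖x ⟨i, j⟩‖ ^ 2)
    (fun _ _ => by positivity) (Finset.mem_univ i)

/-- The second moment of the Hessian form along block-linear functionals of a Gaussian vector. -/
theorem integral_hessian_multivariateGaussian {A : Matrix (BlockIndex d) (BlockIndex d) ℝ}
    (hA : A.PosSemidef) (J : (Fin k → ℝ) → ℝ) (m : Fin k → ℝ) (g : BlockIndex d → ℝ) :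
    ∫ z, fderiv ℝ (fderiv ℝ J) m (fun i => ∑ j, g ⟨i, j⟩ * z ⟨i, j⟩)
      (fun i => ∑ j, g ⟨i, j⟩ * z ⟨i, j⟩) ∂multivariateGaussian 0 A =
    g ⬝ᵥ (A ⊙ blockExpand d (hessian J m)) *ᵥ g := by
  set B := fderiv ℝ (fderiv ℝ J) m with hB
  have hexp : ∀ z : EuclideanSpace ℝ (BlockIndex d),
      B (fun i => ∑ j, g ⟨i, j⟩ * z ⟨i, j⟩) (fun i => ∑ j, g ⟨i, j⟩ * z ⟨i, j⟩) =
      ∑ p, ∑ q, (g p * g q * B (Pi.single p.1 1) (Pi.single q.1 1)) * (z p * z q) := by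
    intro z
    -- Regrouped as a sum over single coordinates, the vector turns the form into a combination of
    -- products `z p * z q`, whose expectations are the entries of `A`.
    have hv : (fun i => ∑ j, g ⟨i, j⟩ * z ⟨i, j⟩ : Fin k → ℝ) =
        ∑ p : BlockIndex d, (g p * z p) • (Pi.single p.1 1 : Fin k → ℝ) := by
      rw [Fintype.sum_sigma]
      ext i
      simp [Finset.sum_apply, Pi.single_apply]
    rw [hv]
    simp only [map_sum, map_smul, sum_apply, smul_apply,
      smul_eq_mul, Finset.mul_sum]
    refine Finset.sum_comm.trans (Finset.sum_congr rfl fun p _ => Finset.sum_congr rfl fun q _ => ?_)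
    ring
  have hi : ∀ p q : BlockIndex d, Integrable (fun z : EuclideanSpace ℝ (BlockIndex d) =>
      z p * z q) (multivariateGaussian 0 A) := fun p q =>
    (memLp_apply_multivariateGaussian A p).integrable_mul (memLp_apply_multivariateGaussian A q)
  simp_rw [hexp]
  rw [integral_finsetSum _ fun p _ => integrable_finsetSum _ fun q _ => (hi p q).const_mul _]
  simp_rw [dotProduct, Matrix.mulVec, dotProduct, Finset.mul_sum]
  refine Finset.sum_congr rfl fun p _ => ?_
  rw [integral_finsetSum _ fun q _ => (hi p q).const_mul _]
  refine Finset.sum_congr rfl fun q _ => ?_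
  rw [integral_const_mul, integral_mul_multivariateGaussian hA]
  simp only [Matrix.hadamard_apply, blockExpand, hessian, Matrix.of_apply, ← hB]
  ring

/-- The Gaussian Jensen inequality for functions with a uniform quadratic approximation. -/
theorem jensen_of_quadApprox {A : Matrix (BlockIndex d) (BlockIndex d) ℝ} (hA : A.PosSemidef)
    {J : (Fin k → ℝ) → ℝ} {U : Set (Fin k → ℝ)} (hU : IsOpen U) (hJ : ContDiffOn ℝ 2 J U)
    {a b : Fin k → ℝ} (hK : Set.Icc a b ⊆ U)
    (hH : ∀ x ∈ Set.Icc a b, (A ⊙ blockExpand d (hessian J x)).PosSemidef)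
    {L : ℝ} (hL : 0 ≤ L) {F : ∀ i, EuclideanSpace ℝ (Fin (d i)) → ℝ}
    {G : ∀ i, EuclideanSpace ℝ (Fin (d i)) → EuclideanSpace ℝ (Fin (d i))}
    (hFG : ∀ i, QuadApprox L (F i) (G i)) (hFb : ∀ i y, F i y ∈ Set.Icc (a i) (b i)) :
    J (fun i => ∫ z, F i (blockProj d i z) ∂multivariateGaussian 0 A) ≤
      ∫ z, J (fun i => F i (blockProj d i z)) ∂multivariateGaussian 0 A := by
  set μ := multivariateGaussian 0 A with hμ
  refine le_of_forall_pos_le_add fun ε hε => ?_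
  have hmean : ∀ ℓ : EuclideanSpace ℝ (BlockIndex d) →L[ℝ] ℝ, ∫ z, ℓ z ∂μ = 0 := fun ℓ => by
    have := ℓ.integral_comp_comm (μ := μ) (φ := fun z => z) IsGaussian.integrable_fun_id
    simpa [hμ] using this
  obtain ⟨δ, hδ, hstep⟩ := exists_jensen_one_step (μ := μ) (integrable_norm_pow_gaussian μ) hmean
    (blockProjL d) norm_blockProj_le hU hJ hK (fun m hm g => by
      have hg : ∀ z, (fun i => ⟪g i, blockProjL d i z⟫_ℝ) = fun i => ∑ j, g i j * z ⟨i, j⟩ := by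
        intro z; ext i; simp [PiLp.inner_apply, blockProj, mul_comm]
      simp only [hg]
      rw [hμ, integral_hessian_multivariateGaussian hA J m (fun p => g p.1 p.2)]
      exact (hH m hm).dotProduct_mulVec_nonneg (fun p : BlockIndex d => g p.1 p.2)) hL hε
  obtain ⟨n, hn⟩ := exists_nat_gt (1 / δ ^ 2)
  have hn0 : (0 : ℝ) < n := lt_trans (by positivity) hn
  set r : ℝ := 1 / √n with hr
  have hr0 : 0 < r := by positivity
  have hr2 : r ^ 2 = 1 / n := by rw [hr, div_pow, Real.sq_sqrt hn0.le, one_pow]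
  have hrδ : r < δ := by
    refine lt_of_pow_lt_pow_left₀ 2 hδ.le ?_
    rw [hr2, div_lt_iff₀ hn0]
    rwa [div_lt_iff₀ (by positivity), mul_comm] at hn
  have hprob : ∀ c : ℝ, IsProbabilityMeasure (μ.map (c • ·)) := fun c =>
    Measure.isProbabilityMeasure_map (by fun_prop)
  have := hprob r
  have hmap : ∀ (c : ℝ) (φ : EuclideanSpace ℝ (BlockIndex d) → ℝ), Measurable φ →
      ∫ z, φ z ∂μ.map (c • ·) = ∫ z, φ (c • z) ∂μ := fun c φ hφ =>
    integral_map (by fun_prop) hφ.aestronglyMeasurable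
  have hJm : ∀ F : ∀ i, EuclideanSpace ℝ (Fin (d i)) → ℝ, (∀ i, Measurable (F i)) →
      (∀ i y, F i y ∈ Set.Icc (a i) (b i)) → ∀ y : ∀ i, EuclideanSpace ℝ (Fin (d i)),
      Measurable fun z => J fun i => F i (y i + blockProjL d i z) := fun F hF hFb y =>
    (continuousOn_iff_continuous_domRestrict.1 (hJ.continuousOn.mono hK)).measurable.comp
      ((measurable_pi_lambda _ fun i => (hF i).comp (by fun_prop)).subtype_mk
        (h := fun z => ⟨fun i => (hFb i _).1, fun i => (hFb i _).2⟩))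
  -- The walk at time `m` has the law of `√m * r` times the Gaussian vector: a Dirac mass at `m =
  -- 0`, and `μ` itself at `m = n`.
  have key := jensen_iterate (ν := μ.map (r • ·)) (κ := fun m => μ.map ((√m * r) • ·))
    (fun m => hprob _) (by simp) (fun m => by
      refine (map_smul_multivariateGaussian_conv hA ?_).symm
      rw [mul_pow, mul_pow, Real.sq_sqrt (by positivity), Real.sq_sqrt (by positivity)]
      push_cast
      ring)
    (blockProjL d) (hJ.continuousOn.mono hK) (L := L) (e := ε * r ^ 2)
    (fun F G hFG hFb y => by
      rw [hmap r _ (hJm F (fun i => (hFG i).measurable) hFb y)]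
      have e : ∀ i, ∫ z, F i (y i + blockProjL d i z) ∂μ.map (r • ·) =
          ∫ z, F i (y i + r • blockProjL d i z) ∂μ := fun i => by
        rw [hmap r (fun z => F i (y i + blockProjL d i z))
          ((hFG i).measurable.comp (by fun_prop))]
        simp only [map_smul]
      simp only [e, map_smul]
      exact hstep r hr0 hrδ F G hFG hFb y) n F G hFG hFb
  have h1 : √(n : ℝ) * r = 1 := by rw [hr]; field_simp
  simp only [h1, one_smul, Measure.map_id', hr2] at key
  refine key.trans (le_of_eq ?_)
  simp only [blockProjL_apply]
  congr 1
  field_simp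

end Gaussian

/-! ### Density of the stable class in `L¹`, with control of the range. -/

section Approximation

open scoped InnerProductSpace Topology

variable {V : Type*} [NormedAddCommGroup V] [InnerProductSpace ℝ V] [MeasurableSpace V]

theorem QuadApprox.mono {L L' : ℝ} {F : V → ℝ} {G : V → V} (h : QuadApprox L F G)
    (hL : L ≤ L') : QuadApprox L' F G :=
  ⟨h.measurable, h.measurable_grad, fun y => (h.norm_le y).trans hL,
    fun y v => (h.approx y v).trans (by gcongr)⟩

theorem QuadApprox.add_const {L : ℝ} {F : V → ℝ} {G : V → V} (h : QuadApprox L F G) (c : ℝ) :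
    QuadApprox L (fun y => F y + c) G :=
  ⟨h.measurable.add_const c, h.measurable_grad, h.norm_le, fun y v => by
    rw [add_sub_add_right_eq_sub]; exact h.approx y v⟩

variable [FiniteDimensional ℝ V] [BorelSpace V]

/-- Take `G` to be the gradient. Compact support makes it bounded and Lipschitz, and the mean value
inequality then gives the quadratic error. -/
theorem exists_quadApprox_of_contDiff {g : V → ℝ} (hg : ContDiff ℝ 2 g)
    (hs : HasCompactSupport g) : ∃ L G, QuadApprox L g G := by
  have hg' : ContDiff ℝ 1 (fderiv ℝ g) := hg.fderiv_right (by norm_num)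
  obtain ⟨C₁, hC₁⟩ := (hs.fderiv ℝ).exists_bound_of_continuous hg'.continuous
  obtain ⟨C₂, hC₂⟩ := hg'.lipschitzWith_of_hasCompactSupport (hs.fderiv ℝ) one_ne_zero
  refine ⟨max C₁ C₂, fun y => (InnerProductSpace.toDual ℝ V).symm (fderiv ℝ g y),
    hg.continuous.measurable, ?_, fun y => ?_, fun y h => ?_⟩
  · exact ((LinearIsometryEquiv.continuous _).comp hg'.continuous).measurable
  · rw [LinearIsometryEquiv.norm_map]
    exact (hC₁ y).trans (le_max_left _ _)
  · rw [InnerProductSpace.toDual_symm_apply]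
    have := (convex_segment y (y + h)).norm_image_sub_le_of_norm_fderiv_le' (𝕜 := ℝ)
      (φ := fderiv ℝ g y) (C := C₂ * ‖h‖)
      (fun x _ => hg.differentiable (by norm_num) x) (fun x hx => ?_)
      (left_mem_segment ℝ _ _) (right_mem_segment ℝ _ _)
    · rw [add_sub_cancel_left, Real.norm_eq_abs] at this
      refine this.trans ?_
      rw [mul_assoc, ← sq]
      gcongr
      exact le_max_right _ _
    · refine (hC₂.norm_sub_le x y).trans ?_
      gcongr
      obtain ⟨θ, hθ, rfl⟩ := segment_eq_image' ℝ y (y + h) ▸ hx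
      rw [add_sub_cancel_left, add_sub_cancel_left, norm_smul, Real.norm_of_nonneg hθ.1]
      exact mul_le_of_le_one_left (norm_nonneg _) hθ.2

/-- Approximation in `L¹` of a measurable function with values in a compact interval. -/
theorem exists_quadApprox_integral_sub_le (ρ : Measure V) [IsProbabilityMeasure ρ] {f : V → ℝ}
    (hf : Measurable f) {a b a' b' : ℝ} (hab : ∀ y, f y ∈ Set.Icc a b) (ha : a' < a) (hb : b < b')
    {ε : ℝ} (hε : 0 < ε) :
    ∃ L F G, QuadApprox L F G ∧ (∀ y, F y ∈ Set.Icc a' b') ∧ ∫ y, |F y - f y| ∂ρ ≤ ε := by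
  have hle : 0 ≤ b - a := sub_nonneg.2 ((hab 0).1.trans (hab 0).2)
  have hfi : Integrable f ρ := Integrable.of_mem_Icc a b hf.aemeasurable (.of_forall hab)
  obtain ⟨g₀, hg₀s, hg₀, hg₀c, hg₀i⟩ :=
    (hfi.sub (integrable_const a)).exists_hasCompactSupport_integral_sub_le (half_pos hε)
  -- Clamping to `[0, b - a]` fixes `0`, which preserves compact support (the reason for working
  -- with `f - a`). It is also 1-Lipschitz and fixes the values of `f - a`, so the `L¹` error does
  -- not grow.
  set g₁ : V → ℝ := fun y => max 0 (min (b - a) (g₀ y)) with hg₁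
  have hg₁s : HasCompactSupport g₁ :=
    hg₀s.comp_left (g := fun t => max 0 (min (b - a) t)) (by simp [hle])
  have hg₁c : Continuous g₁ := by fun_prop
  have hg₁b : ∀ y, g₁ y ∈ Set.Icc 0 (b - a) := fun y =>
    ⟨le_max_left _ _, max_le hle (min_le_left _ _)⟩
  -- The smoothing error must fit in the margins between `[a, b]` and `[a', b']`.
  set η := min (ε / 2) (min (a - a') (b' - b)) with hη
  have hη0 : 0 < η := by
    simp only [hη, lt_min_iff]
    exact ⟨half_pos hε, sub_pos.2 ha, sub_pos.2 hb⟩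
  obtain ⟨g₂, hg₂, hg₂d, hg₂s⟩ := hg₁c.exists_contDiff_approx 2 (ε := fun _ => η)
    continuous_const fun _ => hη0
  obtain ⟨L, G, hG⟩ := exists_quadApprox_of_contDiff hg₂ (hg₁s.mono hg₂s)
  have hd : ∀ y, |g₂ y - g₁ y| ≤ η := fun y => by
    have := (hg₂d y).le
    rwa [Real.dist_eq] at this
  refine ⟨L, fun y => g₂ y + a, G, hG.add_const a, fun y => ?_, ?_⟩
  · have h1 := abs_le.1 (hd y)
    have h2 := hg₁b y
    have h3 : η ≤ a - a' := (min_le_right _ _).trans (min_le_left _ _)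
    have h4 : η ≤ b' - b := (min_le_right _ _).trans (min_le_right _ _)
    constructor <;> linarith [h2.1, h2.2, h1.1, h1.2]
  · have hpt : ∀ y, |g₂ y + a - f y| ≤ η + ‖(f y - a) - g₀ y‖ := by
      intro y
      have h1 : |g₁ y - (f y - a)| ≤ |(f y - a) - g₀ y| := by
        have h0 : f y - a = max 0 (min (b - a) (f y - a)) := by
          rw [min_eq_right (by linarith [(hab y).2]), max_eq_right (by linarith [(hab y).1])]
        rw [abs_sub_comm (f y - a)]
        calc _ = |max 0 (min (b - a) (g₀ y)) - max 0 (min (b - a) (f y - a))| := by rw [← h0]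
          _ ≤ |min (b - a) (g₀ y) - min (b - a) (f y - a)| := by
            simpa using abs_max_sub_max_le_max 0 (min (b - a) (g₀ y)) 0 (min (b - a) (f y - a))
          _ ≤ _ := by
            simpa using abs_min_sub_min_le_max (b - a) (g₀ y) (b - a) (f y - a)
      have : g₂ y + a - f y = (g₂ y - g₁ y) + (g₁ y - (f y - a)) := by ring
      rw [this]
      exact (abs_add_le _ _).trans (add_le_add (hd y) h1)
    have hi : Integrable (fun y => ‖(f y - a) - g₀ y‖) ρ :=
      ((hfi.sub (integrable_const a)).sub hg₀i).norm
    have hgi : Integrable (fun y => |g₂ y + a - f y|) ρ :=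
      ((((integrable_const η).add hi).mono' (((hg₂.continuous.measurable.add_const a).sub
        hf).aestronglyMeasurable) (.of_forall hpt))).abs
    refine (integral_mono hgi ((integrable_const η).add hi) hpt).trans ?_
    simp only [Pi.add_apply]
    rw [integral_add (integrable_const η) hi]
    have : η ≤ ε / 2 := min_le_left _ _
    simp only [integral_const, probReal_univ, smul_eq_mul, one_mul]
    simp only [Pi.sub_apply] at hg₀
    linarith

end Approximation

/-! ### Positivity implies Jensen's inequality for measurable functions. -/

section Direct

open scoped Topology

variable {k : ℕ} {d : Fin k → ℕ}

@[fun_prop]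
theorem measurable_blockProj (i : Fin k) : Measurable (blockProj d i) :=
  (blockProjL d i).continuous.measurable

theorem exists_lt_gt_mem_of_isOpen {s : Set ℝ} (hs : IsOpen s) {a b : ℝ} (ha : a ∈ s)
    (hb : b ∈ s) : ∃ a' b', a' < a ∧ b < b' ∧ a' ∈ s ∧ b' ∈ s := by
  obtain ⟨a', ha', has⟩ := (Filter.Eventually.and (self_mem_nhdsWithin)
    (mem_nhdsWithin_of_mem_nhds (hs.mem_nhds ha)) : ∀ᶠ x in 𝓝[<] a, x < a ∧ x ∈ s).exists
  obtain ⟨b', hb', hbs⟩ := (Filter.Eventually.and (self_mem_nhdsWithin)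
    (mem_nhdsWithin_of_mem_nhds (hs.mem_nhds hb)) : ∀ᶠ x in 𝓝[>] b, b < x ∧ x ∈ s).exists
  exact ⟨a', b', ha', hb', has, hbs⟩

/-- The Gaussian Jensen inequality for measurable functions with values in compact intervals. -/
theorem jensen_of_mem_Icc {A : Matrix (BlockIndex d) (BlockIndex d) ℝ} (hA : A.PosSemidef)
    {Ω : Fin k → Set ℝ} (hΩ : ∀ i, IsOpen (Ω i)) (hΩc : ∀ i, (Ω i).OrdConnected)
    {J : (Fin k → ℝ) → ℝ} (hJ : ContDiffOn ℝ 2 J (Set.univ.pi Ω))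
    (hH : ∀ x ∈ Set.univ.pi Ω, (A ⊙ blockExpand d (hessian J x)).PosSemidef)
    {f : ∀ i, EuclideanSpace ℝ (Fin (d i)) → ℝ} (hf : ∀ i, Measurable (f i))
    {a b : Fin k → ℝ} (ha : ∀ i, a i ∈ Ω i) (hb : ∀ i, b i ∈ Ω i)
    (hfab : ∀ i y, f i y ∈ Set.Icc (a i) (b i)) :
    J (fun i => ∫ z, f i (blockProj d i z) ∂multivariateGaussian 0 A) ≤
      ∫ z, J (fun i => f i (blockProj d i z)) ∂multivariateGaussian 0 A := by
  set μ := multivariateGaussian 0 A with hμ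
  choose a' b' haa hbb ha' hb' using fun i => exists_lt_gt_mem_of_isOpen (hΩ i) (ha i) (hb i)
  have hK : Set.Icc a' b' ⊆ Set.univ.pi Ω := fun x hx i _ =>
    (hΩc i).out (ha' i) (hb' i) ⟨hx.1 i, hx.2 i⟩
  have hJK := hJ.mono hK
  obtain ⟨C, hC⟩ := hJK.exists_lipschitzOnWith two_ne_zero (convex_Icc a' b') isCompact_Icc
  obtain ⟨M, hM⟩ := isCompact_Icc.exists_bound_of_continuousOn hJK.continuousOn
  refine le_of_forall_pos_le_add fun ε hε => ?_
  -- Replacing `f` by `F` costs `C * k * η` on each side of the inequality, `J` being `C`-Lipschitz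
  -- on the enlarged box.
  set η := ε / (2 * (C * k + 1)) with hη
  have hη0 : 0 < η := by positivity
  have hρ : ∀ i, IsProbabilityMeasure (μ.map (blockProj d i)) := fun i =>
    Measure.isProbabilityMeasure_map (by fun_prop)
  choose L F G hFG hFb hFf using fun i => exists_quadApprox_integral_sub_le
    (μ.map (blockProj d i)) (hf i) (hfab i) (haa i) (hbb i) hη0
  have hFG' : ∀ i, QuadApprox (∑ j, |L j|) (F i) (G i) := fun i => (hFG i).mono
    ((le_abs_self _).trans (Finset.single_le_sum (f := fun j => |L j|)
      (fun _ _ => abs_nonneg _) (Finset.mem_univ i)))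
  have key := jensen_of_quadApprox hA (isOpen_set_pi Set.finite_univ fun i _ => hΩ i) hJ hK
    (fun x hx => hH x (hK hx)) (Finset.sum_nonneg fun _ _ => abs_nonneg _) hFG' hFb
  have hfb : ∀ i y, f i y ∈ Set.Icc (a' i) (b' i) := fun i y =>
    ⟨(haa i).le.trans (hfab i y).1, (hfab i y).2.trans (hbb i).le⟩
  have hint : ∀ (h : ∀ i, EuclideanSpace ℝ (Fin (d i)) → ℝ), (∀ i, Measurable (h i)) →
      (∀ i y, h i y ∈ Set.Icc (a' i) (b' i)) → ∀ i,
      Integrable (fun z => h i (blockProj d i z)) μ := fun h hm hb i =>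
    Integrable.of_mem_Icc (a' i) (b' i) ((hm i).comp (by fun_prop)).aemeasurable
      (.of_forall fun _ => hb i _)
  have hJint : ∀ (h : ∀ i, EuclideanSpace ℝ (Fin (d i)) → ℝ), (∀ i, Measurable (h i)) →
      (∀ i y, h i y ∈ Set.Icc (a' i) (b' i)) →
      Integrable (fun z => J (fun i => h i (blockProj d i z))) μ := fun h hm hb =>
    integrable_comp_of_continuousOn hJK.continuousOn hM
      (measurable_pi_lambda _ fun i => (hm i).comp (by fun_prop))
      fun z => ⟨fun i => (hb i _).1, fun i => (hb i _).2⟩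
  have hFm := fun i => (hFG i).measurable
  have hdi : ∀ i, Integrable (fun z => |F i (blockProj d i z) - f i (blockProj d i z)|) μ :=
    fun i => ((hint F hFm hFb i).sub (hint f hf hfb i)).abs
  have hd : ∀ i, ∫ z, |F i (blockProj d i z) - f i (blockProj d i z)| ∂μ ≤ η := fun i => by
    have := hFf i
    rwa [integral_map (f := fun y => |F i y - f i y|) (by fun_prop)
      ((hFm i).sub (hf i)).abs.aestronglyMeasurable] at this
  have hlip : ∀ x ∈ Set.Icc a' b', ∀ y ∈ Set.Icc a' b', J x ≤ J y + C * ∑ i, |x i - y i| := by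
    intro x hx y hy
    have h1 := hC.dist_le_mul x hx y hy
    rw [Real.dist_eq, dist_eq_norm] at h1
    have h2 : ‖x - y‖ ≤ ∑ i, |x i - y i| :=
      (pi_norm_le_iff_of_nonneg (Finset.sum_nonneg fun _ _ => abs_nonneg _)).2 fun i =>
        Finset.single_le_sum (f := fun i => |x i - y i|) (fun _ _ => abs_nonneg _)
          (Finset.mem_univ i)
    have h3 : (C : ℝ) * ‖x - y‖ ≤ C * ∑ i, |x i - y i| := by gcongr
    linarith [le_abs_self (J x - J y)]
  have hmem : ∀ (h : ∀ i, EuclideanSpace ℝ (Fin (d i)) → ℝ), (∀ i, Measurable (h i)) →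
      (∀ i y, h i y ∈ Set.Icc (a' i) (b' i)) →
      (fun i => ∫ z, h i (blockProj d i z) ∂μ) ∈ Set.Icc a' b' := fun h hm hb =>
    ⟨fun i => (integral_mem_Icc ((hm i).comp (by fun_prop)) fun _ => hb i _).1,
      fun i => (integral_mem_Icc ((hm i).comp (by fun_prop)) fun _ => hb i _).2⟩
  have hsum : ∑ _i : Fin k, η = k * η := by simp
  have h1 : J (fun i => ∫ z, f i (blockProj d i z) ∂μ) ≤
      J (fun i => ∫ z, F i (blockProj d i z) ∂μ) + C * (k * η) := by
    refine (hlip _ (hmem f hf hfb) _ (hmem F hFm hFb)).trans ?_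
    rw [← hsum]
    gcongr with i
    rw [← integral_sub (hint f hf hfb i) (hint F hFm hFb i), ← Real.norm_eq_abs]
    refine (norm_integral_le_integral_norm _).trans ((le_of_eq ?_).trans (hd i))
    simp only [Real.norm_eq_abs, abs_sub_comm]
  have h2 : ∫ z, J (fun i => F i (blockProj d i z)) ∂μ ≤
      ∫ z, J (fun i => f i (blockProj d i z)) ∂μ + C * (k * η) := by
    have hsi : Integrable (fun z => C * ∑ i, |F i (blockProj d i z) - f i (blockProj d i z)|) μ :=
      (integrable_finsetSum _ fun i _ => hdi i).const_mul _
    refine (integral_mono (hJint F hFm hFb) ((hJint f hf hfb).add hsi) fun z => hlip _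
      ⟨fun i => (hFb i _).1, fun i => (hFb i _).2⟩ _
      ⟨fun i => (hfb i _).1, fun i => (hfb i _).2⟩).trans ?_
    simp only [Pi.add_apply]
    rw [integral_add (hJint f hf hfb) hsi, integral_const_mul,
      integral_finsetSum _ fun i _ => hdi i, ← hsum]
    gcongr with i
    exact hd i
  have h3 : C * (k * η) * 2 ≤ ε := by
    have : η * (2 * (C * k + 1)) = ε := by rw [hη]; field_simp
    nlinarith
  linarith

/-- Exhaustion of an open subset of the real line by compact subsets. -/
theorem exists_isCompact_seq_of_isOpen {s : Set ℝ} (hs : IsOpen s) :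
    ∃ K : ℕ → Set ℝ, (∀ n, IsCompact (K n)) ∧ (∀ n, K n ⊆ s) ∧
      ∀ x ∈ s, ∀ᶠ n in Filter.atTop, x ∈ K n := by
  obtain ⟨F, hFc, hFs, hFU, hFm⟩ := hs.exists_iUnion_isClosed
  refine ⟨fun n => F n ∩ Metric.closedBall 0 n,
    fun n => (isCompact_closedBall _ _).inter_left (hFc n),
    fun n => Set.inter_subset_left.trans (hFs n), fun x hx => ?_⟩
  obtain ⟨n, hn⟩ := Set.mem_iUnion.1 (hFU.symm ▸ hx)
  obtain ⟨m, hm⟩ := exists_nat_ge (dist x 0)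
  filter_upwards [Filter.eventually_ge_atTop n, Filter.eventually_ge_atTop m] with p hpn hpm
  exact ⟨hFm hpn hn, hm.trans (by exact_mod_cast hpm)⟩

/-- The mean lies between two attained values, so `s` need not be closed. -/
theorem integral_mem_of_ordConnected {S : Type*} [MeasurableSpace S] {ν : Measure S}
    [IsProbabilityMeasure ν] {s : Set ℝ} (hs : s.OrdConnected) {f : S → ℝ}
    (hf : Integrable f ν) (hfs : ∀ x, f x ∈ s) : ∫ x, f x ∂ν ∈ s := by
  obtain ⟨x, hx⟩ := exists_le_integral hf
  obtain ⟨y, hy⟩ := exists_integral_le hf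
  exact hs.out (hfs x) (hfs y) ⟨hx, hy⟩

/-- The Gaussian Jensen inequality. -/
theorem jensen_of_posSemidef {A : Matrix (BlockIndex d) (BlockIndex d) ℝ} (hA : A.PosSemidef)
    {Ω : Fin k → Set ℝ} (hΩ : ∀ i, IsOpen (Ω i)) (hΩc : ∀ i, (Ω i).OrdConnected)
    {J : (Fin k → ℝ) → ℝ} (hJ : ContDiffOn ℝ 2 J (Set.univ.pi Ω))
    {C : ℝ} (hC : ∀ x ∈ Set.univ.pi Ω, |J x| ≤ C)
    (hH : ∀ x ∈ Set.univ.pi Ω, (A ⊙ blockExpand d (hessian J x)).PosSemidef)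
    {f : ∀ i, EuclideanSpace ℝ (Fin (d i)) → ℝ} (hf : ∀ i, Measurable (f i))
    (hfΩ : ∀ i y, f i y ∈ Ω i)
    (hfi : ∀ i, Integrable (fun z => f i (blockProj d i z)) (multivariateGaussian 0 A)) :
    J (fun i => ∫ z, f i (blockProj d i z) ∂multivariateGaussian 0 A) ≤
      ∫ z, J (fun i => f i (blockProj d i z)) ∂multivariateGaussian 0 A := by
  classical
  set μ := multivariateGaussian 0 A with hμ
  choose K hKc hKs hKe using fun i => exists_isCompact_seq_of_isOpen (hΩ i)
  set c : Fin k → ℝ := fun i => ∫ z, f i (blockProj d i z) ∂μ with hc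
  have hcΩ : ∀ i, c i ∈ Ω i := fun i =>
    integral_mem_of_ordConnected (hΩc i) (hfi i) fun _ => hfΩ i _
  -- Outside `K i n` the value is reset to the mean `c i`, which lies in `Ω i`. The range then sits
  -- in a compact subset of `Ω i`, whose least and greatest elements bound an interval inside `Ω i`,
  -- and `|f i| + |c i|` dominates.
  set g : ℕ → ∀ i, EuclideanSpace ℝ (Fin (d i)) → ℝ := fun n i y =>
    if f i y ∈ K i n then f i y else c i with hg
  have hgm : ∀ n i, Measurable (g n i) := fun n i =>
    Measurable.ite ((hKc i n).measurableSet.preimage (hf i)) (hf i) measurable_const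
  have hgK : ∀ n i y, g n i y ∈ insert (c i) (K i n) := fun n i y => by
    simp only [hg]
    split_ifs with h
    · exact Or.inr h
    · exact Or.inl rfl
  have hgΩ : ∀ n i y, g n i y ∈ Ω i := fun n i y =>
    Set.insert_subset (hcΩ i) (hKs i n) (hgK n i y)
  have hge : ∀ i y, ∀ᶠ n in Filter.atTop, g n i y = f i y := fun i y => by
    filter_upwards [hKe i _ (hfΩ i y)] with n hn
    simp [hg, hn]
  have hgn : ∀ n, J (fun i => ∫ z, g n i (blockProj d i z) ∂μ) ≤
      ∫ z, J (fun i => g n i (blockProj d i z)) ∂μ := by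
    intro n
    have hcomp : ∀ i, IsCompact (insert (c i) (K i n)) := fun i => (hKc i n).insert _
    choose a ha using fun i => (hcomp i).exists_isLeast (Set.insert_nonempty _ _)
    choose b hb using fun i => (hcomp i).exists_isGreatest (Set.insert_nonempty _ _)
    have hsub := fun i => Set.insert_subset (hcΩ i) (hKs i n)
    exact jensen_of_mem_Icc hA hΩ hΩc hJ hH (hgm n) (fun i => hsub i (ha i).1)
      (fun i => hsub i (hb i).1) fun i y => ⟨(ha i).2 (hgK n i y), (hb i).2 (hgK n i y)⟩
  have hlim1 : Filter.Tendsto (fun n => J (fun i => ∫ z, g n i (blockProj d i z) ∂μ))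
      Filter.atTop (𝓝 (J c)) := by
    have hJc : ContinuousAt J c := hJ.continuousOn.continuousAt
      ((isOpen_set_pi Set.finite_univ fun i _ => hΩ i).mem_nhds fun i _ => hcΩ i)
    refine hJc.tendsto.comp (tendsto_pi_nhds.2 fun i => ?_)
    refine tendsto_integral_of_dominated_convergence
      (fun z => |f i (blockProj d i z)| + |c i|)
      (fun n => ((hgm n i).comp (by fun_prop)).aestronglyMeasurable)
      ((hfi i).abs.add (integrable_const _)) (fun n => .of_forall fun z => ?_)
      (.of_forall fun z => tendsto_const_nhds.congr' ?_)
    · simp only [hg, Real.norm_eq_abs]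
      split_ifs
      · exact le_add_of_nonneg_right (abs_nonneg _)
      · exact le_add_of_nonneg_left (abs_nonneg _)
    · filter_upwards [hge i (blockProj d i z)] with n hn using hn.symm
  have hJm : ∀ n, Integrable (fun z => J (fun i => g n i (blockProj d i z))) μ := fun n =>
    integrable_comp_of_continuousOn hJ.continuousOn hC
      (measurable_pi_lambda _ fun i => (hgm n i).comp (by fun_prop)) fun z i _ => hgΩ n i _
  have hlim2 : Filter.Tendsto (fun n => ∫ z, J (fun i => g n i (blockProj d i z)) ∂μ)
      Filter.atTop (𝓝 (∫ z, J (fun i => f i (blockProj d i z)) ∂μ)) := by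
    refine tendsto_integral_of_dominated_convergence (fun _ => C)
      (fun n => (hJm n).aestronglyMeasurable) (integrable_const _)
      (fun n => .of_forall fun z => hC _ fun i _ => hgΩ n i _)
      (.of_forall fun z => tendsto_const_nhds.congr' ?_)
    filter_upwards [Filter.eventually_all.2 fun i => hge i (blockProj d i z)] with n hn
    simp only [hn]
  exact le_of_tendsto_of_tendsto' hlim1 hlim2 hgn

end Direct

/-! ### Jensen's inequality implies positivity. -/

section Converse

open scoped Topology

variable {k : ℕ} {d : Fin k → ℕ}

/-- If Jensen's inequality holds for all small perturbations of `x` by multiples of a bounded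
centered `h`, then the expectation of the Hessian form at `x` along `h` is nonnegative. -/
theorem integral_hessian_nonneg_of_jensen {S : Type*} [MeasurableSpace S] {ν : Measure S}
    [IsProbabilityMeasure ν] {J : (Fin k → ℝ) → ℝ} {U : Set (Fin k → ℝ)} (hU : IsOpen U)
    (hJ : ContDiffOn ℝ 2 J U) {x : Fin k → ℝ} (hx : x ∈ U) {h : S → Fin k → ℝ}
    (hm : Measurable h) {c : ℝ} (hc : ∀ z, ‖h z‖ ≤ c) (h0 : ∫ z, h z ∂ν = 0)
    {δ : ℝ} (hδ : 0 < δ)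
    (hjen : ∀ s, 0 < s → s * c ≤ δ → J x ≤ ∫ z, J (x + s • h z) ∂ν) :
    0 ≤ ∫ z, fderiv ℝ (fderiv ℝ J) x (h z) (h z) ∂ν := by
  obtain ⟨z₀⟩ : Nonempty S := ν.nonempty_of_neZero
  have hc0 : 0 ≤ c := (norm_nonneg _).trans (hc z₀)
  obtain ⟨δ', hδ', hball⟩ := Metric.nhds_basis_closedBall.mem_iff.1 (hU.mem_nhds hx)
  set B := fderiv ℝ (fderiv ℝ J) x with hB
  have hhi : Integrable h ν := Integrable.of_bound hm.aestronglyMeasurable c (.of_forall hc)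
  have hBi : Integrable (fun z => B (h z) (h z)) ν := by
    refine Integrable.of_bound ?_ (‖B‖ * c * c) (.of_forall fun z => ?_)
    · exact ((by fun_prop : Continuous fun v => B v v).measurable.comp hm).aestronglyMeasurable
    · refine (B.le_opNorm₂ _ _).trans ?_
      have := hc z
      gcongr
  by_contra! hneg
  set I := ∫ z, B (h z) (h z) ∂ν with hI
  -- Then `2 * ε * c ^ 2 ≤ -I / 4`, so the coefficient `I / 2 + 2 * ε * c ^ 2` of `s ^ 2` is
  -- negative. The choice of `s` keeps `x + s • h z` in the ball and absorbs the cubic remainder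
  -- into the quadratic one.
  set ε := -I / (8 * (c ^ 2 + 1)) with hε
  have hε0 : 0 < ε := div_pos (by linarith) (by positivity)
  obtain ⟨C, hC0, hC⟩ := exists_abs_taylor_two_le hU hJ (isCompact_closedBall x δ')
    (convex_closedBall x δ') hball hε0
  set s := min (min δ δ' / (c + 1)) (ε / (C * c + 1)) with hs
  have hs0 : 0 < s := by positivity
  have hsc : s * c ≤ min δ δ' := by
    have h1 : s * (c + 1) ≤ min δ δ' := (le_div_iff₀ (by positivity)).1 (min_le_left _ _)
    linarith
  have hsC : s * (C * c) ≤ ε := by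
    have h1 : s * (C * c + 1) ≤ ε := (le_div_iff₀ (by positivity)).1 (min_le_right _ _)
    linarith
  have hsn : ∀ z, ‖s • h z‖ ≤ s * c := fun z => by
    rw [norm_smul, Real.norm_of_nonneg hs0.le]
    gcongr
    exact hc z
  have hmem : ∀ z, x + s • h z ∈ Metric.closedBall x δ' := fun z => by
    rw [mem_closedBall_iff_norm, add_sub_cancel_left]
    exact (hsn z).trans (hsc.trans (min_le_right _ _))
  have hJc : ContinuousOn J (Metric.closedBall x δ') := hJ.continuousOn.mono hball
  obtain ⟨M, hM⟩ := (isCompact_closedBall x δ').exists_bound_of_continuousOn hJc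
  have hJi : Integrable (fun z => J (x + s • h z)) ν :=
    integrable_comp_of_continuousOn hJc hM (by fun_prop) hmem
  have hpt : ∀ z, J (x + s • h z) ≤
      (J x + s * fderiv ℝ J x (h z)) + ((s ^ 2 / 2) * B (h z) (h z) + 2 * ε * s ^ 2 * c ^ 2) := by
    intro z
    have h1 := (abs_le.1 (hC x (Metric.mem_closedBall_self hδ'.le) _ (hmem z))).2
    rw [add_sub_cancel_left] at h1
    have h2 : ε * ‖s • h z‖ ^ 2 ≤ ε * (s * c) ^ 2 := by gcongr; exact hsn z
    have h3 : C * ‖s • h z‖ ^ 3 ≤ C * (s * c) ^ 3 := by gcongr; exact hsn z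
    have h4 : C * (s * c) ^ 3 ≤ ε * (s * c) ^ 2 := by
      calc C * (s * c) ^ 3 = (s * (C * c)) * (s * c) ^ 2 := by ring
        _ ≤ _ := by gcongr
    simp only [map_smul, smul_apply, smul_eq_mul, ← hB] at h1
    linarith
  have hDi : Integrable (fun z => fderiv ℝ J x (h z)) ν := (fderiv ℝ J x).integrable_comp hhi
  have hDz : ∫ z, fderiv ℝ J x (h z) ∂ν = 0 := by
    rw [(fderiv ℝ J x).integral_comp_comm hhi, h0, map_zero]
  have hi1 : Integrable (fun z => J x + s * fderiv ℝ J x (h z)) ν :=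
    (integrable_const _).add (hDi.const_mul s)
  have hi2 : Integrable (fun z => (s ^ 2 / 2) * B (h z) (h z) + 2 * ε * s ^ 2 * c ^ 2) ν :=
    (hBi.const_mul _).add (integrable_const _)
  have key := (hjen s hs0 (hsc.trans (min_le_left _ _))).trans
    (integral_mono hJi (hi1.add hi2) hpt)
  simp only [Pi.add_apply] at key
  rw [integral_add hi1 hi2, integral_add (integrable_const _) (hDi.const_mul s),
    integral_add (hBi.const_mul _) (integrable_const _), integral_const_mul, integral_const_mul,
    hDz, ← hI] at key
  simp only [integral_const, probReal_univ, smul_eq_mul, one_mul, mul_zero, add_zero] at key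
  have h5 : 0 ≤ s ^ 2 * (I / 2 + 2 * ε * c ^ 2) := by linarith
  have h6 : 0 ≤ I / 2 + 2 * ε * c ^ 2 := nonneg_of_mul_nonneg_right h5 (by positivity)
  have h7 : ε * (8 * (c ^ 2 + 1)) = -I := by rw [hε]; field_simp
  nlinarith

theorem abs_max_neg_min_le_abs {R : ℝ} (hR : 0 ≤ R) (t : ℝ) : |max (-R) (min R t)| ≤ |t| := by
  rcases abs_cases t with ⟨h, h'⟩ | ⟨h, h'⟩ <;> rw [h, abs_le] <;> constructor
  · exact le_trans (by linarith) (le_max_of_le_right (le_min hR h'))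
  · exact max_le (by linarith) (min_le_right _ _)
  · rw [neg_neg]
    exact le_max_of_le_right (le_min (by linarith) le_rfl)
  · exact max_le (by linarith) ((min_le_right _ _).trans (by linarith))

theorem abs_max_neg_min_le {R : ℝ} (hR : 0 ≤ R) (t : ℝ) : |max (-R) (min R t)| ≤ R :=
  abs_le.2 ⟨le_max_left _ _, max_le (by linarith) (min_le_left _ _)⟩

/-- The Gaussian Jensen inequality forces positivity of the block-Hadamard product. -/
theorem posSemidef_of_jensen {A : Matrix (BlockIndex d) (BlockIndex d) ℝ} (hA : A.PosSemidef)
    {Ω : Fin k → Set ℝ} (hΩ : ∀ i, IsOpen (Ω i))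
    {J : (Fin k → ℝ) → ℝ} (hJ : ContDiffOn ℝ 2 J (Set.univ.pi Ω))
    (hjen : ∀ f : ∀ i, EuclideanSpace ℝ (Fin (d i)) → ℝ, (∀ i, Measurable (f i)) →
      (∀ i y, f i y ∈ Ω i) →
      (∀ i, Integrable (fun z => f i (blockProj d i z)) (multivariateGaussian 0 A)) →
      J (fun i => ∫ z, f i (blockProj d i z) ∂multivariateGaussian 0 A) ≤
        ∫ z, J (fun i => f i (blockProj d i z)) ∂multivariateGaussian 0 A)
    {x : Fin k → ℝ} (hx : x ∈ Set.univ.pi Ω) :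
    (A ⊙ blockExpand d (hessian J x)).PosSemidef := by
  set μ := multivariateGaussian 0 A with hμ
  have hU : IsOpen (Set.univ.pi Ω) := isOpen_set_pi Set.finite_univ fun i _ => hΩ i
  have hsymm := (hJ.contDiffAt (hU.mem_nhds hx)).isSymmSndFDerivAt (by simp)
  refine .of_dotProduct_mulVec_nonneg (Matrix.IsHermitian.ext fun p q => ?_) fun u => ?_
  · have h1 := hA.isHermitian.apply p q
    simp only [star_trivial] at h1
    simp only [star_trivial, Matrix.hadamard_apply, blockExpand, hessian, Matrix.of_apply, h1]
    rw [hsymm]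
  rw [star_trivial, ← integral_hessian_multivariateGaussian hA J x u, ← hμ]
  set B := fderiv ℝ (fderiv ℝ J) x with hB
  obtain ⟨δ, hδ, hball⟩ := Metric.nhds_basis_closedBall.mem_iff.1 (hU.mem_nhds hx)
  let W : EuclideanSpace ℝ (BlockIndex d) →L[ℝ] (Fin k → ℝ) :=
    ContinuousLinearMap.pi fun i => ∑ j, u ⟨i, j⟩ • EuclideanSpace.proj (𝕜 := ℝ) ⟨i, j⟩
  have hW : ∀ z, W z = fun i => ∑ j, u ⟨i, j⟩ * z ⟨i, j⟩ := fun z => by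
    ext i; simp [W]
  simp only [← hW]
  have hWi : Integrable (fun z => W z) μ := W.integrable_comp IsGaussian.integrable_fun_id
  have hWm : ∫ z, W z ∂μ = 0 := by
    rw [W.integral_comp_comm IsGaussian.integrable_fun_id]
    simp [hμ]
  let ℓ : ∀ i, EuclideanSpace ℝ (Fin (d i)) → ℝ := fun i y => ∑ j, u ⟨i, j⟩ * y j
  have hℓ : ∀ i, Measurable (ℓ i) := fun i => by simp only [ℓ]; fun_prop
  have hℓW : ∀ i z, ℓ i (blockProj d i z) = W z i := fun i z => by rw [hW]; rfl
  let τ : ℕ → ℝ → ℝ := fun R t => max (-R) (min R t)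
  have hτ : ∀ R, Measurable (τ R) := fun R => by simp only [τ]; fun_prop
  have hτR : ∀ R t, |τ R t| ≤ R := fun R t => abs_max_neg_min_le R.cast_nonneg t
  have hτt : ∀ R t, |τ R t| ≤ |t| := fun R t => abs_max_neg_min_le_abs R.cast_nonneg t
  have hτe : ∀ t, ∀ᶠ R in Filter.atTop, τ R t = t := fun t => by
    obtain ⟨n, hn⟩ := exists_nat_ge |t|
    filter_upwards [Filter.eventually_ge_atTop n] with R hR
    have h1 := abs_le.1 (hn.trans (by exact_mod_cast hR : (n : ℝ) ≤ R))
    simp only [τ]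
    rw [min_eq_right h1.2, max_eq_right h1.1]
  let c : ℕ → Fin k → ℝ := fun R i => ∫ z, τ R (W z i) ∂μ
  have hWm' : ∀ i, Measurable fun z => W z i := fun i => by fun_prop
  have hcR : ∀ R i, |c R i| ≤ R := fun R i => by
    simpa using norm_integral_le_of_norm_le_const (μ := μ) (f := fun z => τ R (W z i))
      (.of_forall fun z => hτR R (W z i))
  have hcW : ∀ R i, |c R i| ≤ ∫ z, ‖W z‖ ∂μ := fun R i =>
    norm_integral_le_of_norm_le (f := fun z => τ R (W z i)) hWi.norm
      (.of_forall fun z => (hτt R (W z i)).trans (norm_le_pi_norm (W z) i))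
  have hc0 : ∀ i, Filter.Tendsto (fun R => c R i) Filter.atTop (𝓝 0) := fun i => by
    have h0 : ∫ z, W z i ∂μ = 0 := by
      rw [← eval_integral fun i => hWi.eval i, hWm]; rfl
    rw [← h0]
    refine tendsto_integral_of_dominated_convergence (fun z => |W z i|)
      (fun R => ((hτ R).comp (hWm' i)).aestronglyMeasurable) (hWi.eval i).abs
      (fun R => .of_forall fun z => hτt R _)
      (.of_forall fun z => tendsto_const_nhds.congr' ?_)
    filter_upwards [hτe (W z i)] with R hR using hR.symm
  -- Truncation makes the perturbation bounded, so that a small multiple stays in `Ω`. Subtracting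
  -- `c R` keeps the mean of the test functions exactly at `x`; no symmetry is needed, only `c R →
  -- 0`.
  let h : ℕ → EuclideanSpace ℝ (BlockIndex d) → Fin k → ℝ := fun R z i => τ R (W z i) - c R i
  have hhm : ∀ R, Measurable (h R) := fun R => measurable_pi_lambda _ fun i =>
    ((hτ R).comp (hWm' i)).sub_const _
  have hτi : ∀ R i, Integrable (fun z => τ R (W z i)) μ := fun R i =>
    Integrable.of_bound ((hτ R).comp (hWm' i)).aestronglyMeasurable R
      (.of_forall fun z => hτR R _)
  have hhR : ∀ R z, ‖h R z‖ ≤ 2 * R := fun R z =>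
    (pi_norm_le_iff_of_nonneg (by positivity)).2 fun i =>
      (abs_sub _ _).trans (by linarith [hτR R (W z i), hcR R i])
  -- Unlike the bound `2 * R`, this one is uniform in `R` and square-integrable; it dominates the
  -- limit `R → ∞`.
  have hhW : ∀ R z, ‖h R z‖ ≤ ‖W z‖ + ∫ z, ‖W z‖ ∂μ := fun R z =>
    (pi_norm_le_iff_of_nonneg
      (add_nonneg (norm_nonneg _) (integral_nonneg fun _ => norm_nonneg _))).2 fun i =>
      (abs_sub _ _).trans
        (add_le_add ((hτt R (W z i)).trans (norm_le_pi_norm (W z) i)) (hcW R i))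
  have hh0 : ∀ R i, ∫ z, h R z i ∂μ = 0 := fun R i => by
    simp only [h]
    rw [integral_sub (hτi R i) (integrable_const _)]
    simp [c]
  have hhi : ∀ R i, Integrable (fun z => h R z i) μ := fun R i =>
    (hτi R i).sub (integrable_const _)
  have hpos : ∀ R, 0 ≤ ∫ z, B (h R z) (h R z) ∂μ := by
    intro R
    refine integral_hessian_nonneg_of_jensen hU hJ hx (hhm R) (hhR R) ?_ hδ fun s hs hsδ => ?_
    · ext i
      rw [eval_integral fun i => hhi R i, hh0]; rfl
    · let f : ∀ i, EuclideanSpace ℝ (Fin (d i)) → ℝ := fun i y => x i + s * (τ R (ℓ i y) - c R i)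
      have hf : ∀ z, (fun i => f i (blockProj d i z)) = x + s • h R z := fun z => by
        ext i; simp [f, h, hℓW]
      have hfm : ∀ i, Measurable (f i) := fun i =>
        ((((hτ R).comp (hℓ i)).sub_const _).const_mul s).const_add _
      have hfΩ : ∀ i y, f i y ∈ Ω i := by
        intro i y
        -- Moving only the `i`-th coordinate of `x` stays in the ball, hence in the product, which
        -- yields membership in `Ω i`.
        have hmem : x + Pi.single i (s * (τ R (ℓ i y) - c R i)) ∈ Set.univ.pi Ω := by
          refine hball ?_
          rw [mem_closedBall_iff_norm, add_sub_cancel_left, Pi.norm_single, norm_mul,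
            Real.norm_of_nonneg hs.le]
          refine le_trans ?_ hsδ
          gcongr
          exact (abs_sub _ _).trans (by linarith [hτR R (ℓ i y), hcR R i])
        simpa [f] using hmem i (Set.mem_univ i)
      have hfe : ∀ i, (fun z => f i (blockProj d i z)) = fun z => x i + s * h R z i := fun i => by
        ext z; simp [f, h, hℓW]
      have hfi : ∀ i, Integrable (fun z => f i (blockProj d i z)) μ := fun i => by
        rw [hfe]; exact (integrable_const _).add ((hhi R i).const_mul s)
      have hfint : (fun i => ∫ z, f i (blockProj d i z) ∂μ) = x := by
        ext i
        rw [hfe, integral_add (integrable_const _) ((hhi R i).const_mul s), integral_const_mul,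
          hh0]
        simp
      have := hjen f hfm hfΩ hfi
      rw [hfint] at this
      simpa only [hf] using this
  refine ge_of_tendsto' (tendsto_integral_of_dominated_convergence
    (fun z => ‖B‖ * (‖W z‖ + ∫ z, ‖W z‖ ∂μ) ^ 2) (fun R => ?_) ?_ (fun R => .of_forall fun z => ?_)
    (.of_forall fun z => ?_)) hpos
  · exact ((by fun_prop : Continuous fun v => B v v).measurable.comp
      (hhm R)).aestronglyMeasurable
  · have hW2 : MemLp (fun z => ‖W z‖) 2 μ :=
      ((IsGaussian.memLp_two_id (μ := μ)).continuousLinearMap_comp W).norm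
    exact ((hW2.add (memLp_const _)).integrable_sq).const_mul _
  · refine (B.le_opNorm₂ _ _).trans ?_
    rw [mul_assoc, ← sq]
    gcongr
    exact hhW R z
  · have hlim : Filter.Tendsto (fun R => h R z) Filter.atTop (𝓝 (W z)) := by
      refine tendsto_pi_nhds.2 fun i => ?_
      have h1 : Filter.Tendsto (fun R => τ R (W z i)) Filter.atTop (𝓝 (W z i)) :=
        tendsto_const_nhds.congr' (by filter_upwards [hτe (W z i)] with R hR using hR.symm)
      simpa using h1.sub (hc0 i)
    exact ((by fun_prop : Continuous fun v => B v v).tendsto (W z)).comp hlim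

end Converse

end GaussianJensen

/-! ### The equivalence: both sides depend on `X` only through its law. -/

theorem mainTheorem3 {k : ℕ} (d : Fin k → ℕ) (hd : ∀ i, 1 ≤ d i)
    (A : Matrix (GaussianJensen.BlockIndex d) (GaussianJensen.BlockIndex d) ℝ)
    (hA : A.PosSemidef)
    (Ω : Fin k → Set ℝ) (hΩ_open : ∀ i, IsOpen (Ω i)) (hΩ_interval : ∀ i, (Ω i).OrdConnected)
    {S : Type*} [MeasurableSpace S] (P : Measure S) [IsProbabilityMeasure P]
    (X : S → EuclideanSpace ℝ (GaussianJensen.BlockIndex d))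
    (hX : HasLaw X (multivariateGaussian 0 A) P)
    (J : (Fin k → ℝ) → ℝ) (hJ_C2 : ContDiffOn ℝ 2 J (Set.univ.pi Ω))
    (hJ_bdd : ∃ C : ℝ, ∀ x ∈ Set.univ.pi Ω, |J x| ≤ C) :
    (∀ x ∈ Set.univ.pi Ω,
        (A ⊙ GaussianJensen.blockExpand d (GaussianJensen.hessian J x)).PosSemidef) ↔
      (∀ f : (i : Fin k) → EuclideanSpace ℝ (Fin (d i)) → ℝ,
        (∀ i, Measurable (f i)) →
        (∀ i y, f i y ∈ Ω i) →
        (∀ i, Integrable (fun ω => f i (GaussianJensen.blockProj d i (X ω))) P) →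
        J (fun i => ∫ ω, f i (GaussianJensen.blockProj d i (X ω)) ∂P) ≤
          ∫ ω, J (fun i => f i (GaussianJensen.blockProj d i (X ω))) ∂P) := by
  obtain ⟨C, hC⟩ := hJ_bdd
  have hint : ∀ φ : EuclideanSpace ℝ (GaussianJensen.BlockIndex d) → ℝ,
      AEStronglyMeasurable φ (multivariateGaussian 0 A) →
      ∫ ω, φ (X ω) ∂P = ∫ z, φ z ∂multivariateGaussian 0 A := fun φ hφ => hX.integral_comp hφ
  have hi : ∀ φ : EuclideanSpace ℝ (GaussianJensen.BlockIndex d) → ℝ,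
      AEStronglyMeasurable φ (multivariateGaussian 0 A) →
      (Integrable (fun ω => φ (X ω)) P ↔ Integrable φ (multivariateGaussian 0 A)) :=
    fun φ hφ => by
      rw [← hX.map_eq] at hφ ⊢
      exact (integrable_map_measure hφ hX.aemeasurable).symm
  have hfm : ∀ f : (i : Fin k) → EuclideanSpace ℝ (Fin (d i)) → ℝ, (∀ i, Measurable (f i)) → ∀ i,
      AEStronglyMeasurable (fun z => f i (GaussianJensen.blockProj d i z))
        (multivariateGaussian 0 A) :=
    fun f hf i => ((hf i).comp (by fun_prop)).aestronglyMeasurable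
  have hJm : ∀ f : (i : Fin k) → EuclideanSpace ℝ (Fin (d i)) → ℝ, (∀ i, Measurable (f i)) →
      (∀ i y, f i y ∈ Ω i) →
      AEStronglyMeasurable (fun z => J fun i => f i (GaussianJensen.blockProj d i z))
        (multivariateGaussian 0 A) := fun f hf hfΩ =>
    (GaussianJensen.integrable_comp_of_continuousOn hJ_C2.continuousOn hC
      (measurable_pi_lambda _ fun i => (hf i).comp (by fun_prop))
      fun z i _ => hfΩ i _).aestronglyMeasurable
  constructor
  · intro hH f hf hfΩ hfi
    simp only [hint _ (hfm f hf _), hint _ (hJm f hf hfΩ)]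
    exact GaussianJensen.jensen_of_posSemidef hA hΩ_open hΩ_interval hJ_C2 hC hH hf hfΩ
      fun i => (hi _ (hfm f hf i)).1 (hfi i)
  · intro hjen x hx
    refine GaussianJensen.posSemidef_of_jensen hA hΩ_open hJ_C2 (fun f hf hfΩ hfi => ?_) hx
    have := hjen f hf hfΩ fun i => (hi _ (hfm f hf i)).2 (hfi i)
    simpa only [hint _ (hfm f hf _), hint _ (hJm f hf hfΩ)] using this
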